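/- Let $k,\sigma,\delta,L,\hat L>0$, $a_1\in\mathbb R$ and $N\ge 2$. Put $a_j=a_1+(j-1)L$, $b_j=a_j+L+2\delta$ and $\Omega_j=(a_j,b_j)\times(0,\hat L)$ for $1\le j\le N$, so that neighbouring strips overlap by $2\delta$. With $\mathcal B_l u=-\partial_x u+ik\,u$ and $\mathcal B_r u=\partial_x u+ik\,u$, consider on $(a_1,b_N)\times(0,\hat L)$ the absorptive Helmholtz wave-guide problem $(ik\sigma-k^2)u-(\partial_{xx}+\partial_{yy})u=f$, $u=0$ for $y\in\{0,\hat L\}$, $\mathcal B_l u=g_1$ at $x=a_1$, $\mathcal B_r u=g_2$ at $x=b_N$, and the parallel Schwarz method for it: $u_j^n$ solves the same equation with the same Dirichlet condition in $\Omega_j$, with $\mathcal B_l u_j^n=\mathcal B_l u_{j-1}^{n-1}$ at $x=a_j$ ($j\ge2$), $\mathcal B_r u_j^n=\mathcal B_r u_{j+1}^{n-1}$ at $x=b_j$ ($j\le N-1$), $\mathcal B_l u_1^n=g_1$ at $x=a_1$ and $\mathcal B_r u_N^n=g_2$ at $x=b_N$. Let $e_j^n=u|_{\Omega_j}-u_j^n$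 and let $\mathcal R^n(\tilde k)\in\mathbb C^{2(N-1)}$ be the vector of the Fourier sine coefficients, at the Fourier number $\tilde k=m\pi/\hat L$ ($m\ge1$), of the Robin interface data $[\mathcal B_r e_2^n(b_1,\cdot),\mathcal B_l e_1^n(a_2,\cdot),\mathcal B_r e_3^n(b_2,\cdot),\mathcal B_l e_2^n(a_3,\cdot),\dots,\mathcal B_r e_N^n(b_{N-1},\cdot),\mathcal B_l e_{N-1}^n(a_N,\cdot)]$. For real $\tilde k>0$ let $\zeta=\sqrt{ik\sigma+\tilde k^2-k^2}$ (principal branch), $\alpha=ik$, $D=(\zeta+\alpha)^2e^{\zeta(2\delta+L)}-(\zeta-\alpha)^2e^{-\zeta(2\delta+L)}$, $$a=\frac{(\zeta+\alpha)^2e^{2\zeta\delta}-(\zeta-\alpha)^2e^{-2\zeta\delta}}{D},\qquad b=-\frac{(\zeta^2-\alpha^2)(e^{\zeta L}-e^{-\zeta L})}{D},$$ and let $\mathcal T_N(\tilde k)\in\mathbb C^{2(N-1)\times2(N-1)}$ be the block tridiagonal block Toeplitz matrix with diagonal, superdiagonal and subdiagonal blocks $\begin{pmatrix}0&b\\b&0\end{pmatrix}$,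 $\begin{pmatrix}a&0\\0&0\end{pmatrix}$, $\begin{pmatrix}0&0\\0&a\end{pmatrix}$. Write $\rho$ for the spectral radius, and $$R_{1d}^{\mathrm H}(\tilde k)=\lim_{N\to\infty}\rho(\mathcal T_N(\tilde k)),\qquad R_{2d}^{\mathrm H}=\sup_{m\ge1}R_{1d}^{\mathrm H}(m\pi/\hat L).$$ **Theorem (convergence of the Schwarz algorithm for Helmholtz in 2D).** 1. For all $N\ge2$, $m\ge1$ and $\tilde k=m\pi/\hat L$, the matrix $\mathcal T_N(\tilde k)$ is the unique matrix $T$ such that $\mathcal R^{n+1}(\tilde k)=T\,\mathcal R^{n}(\tilde k)$ for every $n\ge0$ and all $a_1,f,g_1,g_2$, all solutions $u$ and all Schwarz iterations $(u_j^n)$ with initial guess $(u_j^0)$, where $u$ and all $u_j^n$ are $C^2$ up to the boundary. 2. The limit $R_{1d}^{\mathrm H}(\tilde k)$ exists for all $k,\sigma,\delta,L,\tilde k>0$. 3. (Evanescent modes.) $R_{1d}^{\mathrm H}(\tilde k)<1$ for all $k,\sigma,\delta,L>0$ and all $\tilde k>k$. 4. (Between them $\sigma,\delta,L$ sufficiently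 large.) For every $k>0$ and $\varepsilon>0$ there is $C=C(k,\varepsilon)>0$ such that $R_{2d}^{\mathrm H}<1$ for all $\sigma\ge\varepsilon$ and $\delta,L,\hat L>0$ with $\max\{\sigma,\delta,L\}\ge C$. 5. In particular, if $\sigma\ge k>0$ then $R_{2d}^{\mathrm H}<1$ for all $\delta,L,\hat L>0$. 6. (Scaling.) Whenever $R_{2d}^{\mathrm H}<1$, there are $q<1$ and $N_0$ such that $\rho(\mathcal T_N(m\pi/\hat L))\le q$ for all $N\ge N_0$ and all $m\ge1$. -/

import Mathlib

open Filter Topology Matrix MeasureTheory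

noncomputable section

namespace Waveguide

/-! ### Strip decomposition, boundary operators and the parallel Schwarz method -/

/-- Left end `a_j = a₁ + (j - 1) L` of the `j`-th strip (`j = 1, …, N`). -/
def leftEnd (a₁ L : ℝ) (j : ℕ) : ℝ := a₁ + ((j : ℝ) - 1) * L

/-- Right end `b_j = a_j + L + 2 δ` of the `j`-th strip, so that consecutive strips overlap by
`b_{j-1} - a_j = 2 δ`. -/
def rightEnd (a₁ L δ : ℝ) (j : ℕ) : ℝ := leftEnd a₁ L j + L + 2 * δ

/-- `∂ₓ w (x, y)`. -/
def dx (w : ℝ → ℝ → ℂ) (x y : ℝ) : ℂ := deriv (fun s => w s y) x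

/-- `∂ₓₓ w (x, y)`. -/
def dxx (w : ℝ → ℝ → ℂ) (x y : ℝ) : ℂ := deriv (deriv (fun s => w s y)) x

/-- `∂_yy w (x, y)`. -/
def dyy (w : ℝ → ℝ → ℂ) (x y : ℝ) : ℂ := deriv (deriv (fun s => w x s)) y

/-- The left Robin (impedance) operator `-∂ₓ w + α w`. -/
def robinLeft (α : ℂ) (w : ℝ → ℝ → ℂ) (x y : ℝ) : ℂ := -dx w x y + α * w x y

/-- The right Robin (impedance) operator `∂ₓ w + α w`. -/
def robinRight (α : ℂ) (w : ℝ → ℝ → ℂ) (x y : ℝ) : ℂ := dx w x y + α * w x y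

/-- The classical impedance parameter `α = i k`. -/
def impedance (k : ℝ) : ℂ := Complex.I * k

/-- `w` is of class `C²` up to the boundary (it is the restriction of a `C²` function on the
plane), solves `(i k σ - k²) w - (∂ₓₓ + ∂_yy) w = f` in `(p, q) × (0, H)`, and vanishes on the top
and bottom boundaries `y = 0` and `y = H`. -/
structure SolvesInStrip (k σ H : ℝ) (f : ℝ → ℝ → ℂ) (p q : ℝ) (w : ℝ → ℝ → ℂ) : Prop where
  smooth : ContDiff ℝ 2 (fun z : ℝ × ℝ => w z.1 z.2)
  equation : ∀ x ∈ Set.Ioo p q, ∀ y ∈ Set.Ioo 0 H,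
    (Complex.I * k * σ - (k : ℂ) ^ 2) * w x y - (dxx w x y + dyy w x y) = f x y
  dirichlet_bottom : ∀ x ∈ Set.Ioo p q, w x 0 = 0
  dirichlet_top : ∀ x ∈ Set.Ioo p q, w x H = 0

/-- `u` solves the wave-guide problem in the whole domain `(a₁, b_N) × (0, H)`, with impedance data
`g₁` and `g₂` at its two ends. -/
structure IsWaveguideSolution (k σ δ L H : ℝ) (N : ℕ) (a₁ : ℝ) (f : ℝ → ℝ → ℂ) (g₁ g₂ : ℝ → ℂ)
    (u : ℝ → ℝ → ℂ) : Prop where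
  interior : SolvesInStrip k σ H f (leftEnd a₁ L 1) (rightEnd a₁ L δ N) u
  left_end : ∀ y ∈ Set.Ioo 0 H, robinLeft (impedance k) u (leftEnd a₁ L 1) y = g₁ y
  right_end : ∀ y ∈ Set.Ioo 0 H, robinRight (impedance k) u (rightEnd a₁ L δ N) y = g₂ y

/-- `U n j` is the `n`-th iterate of the parallel Schwarz method in the `j`-th strip
`(a_j, b_j) × (0, H)`, `j = 1, …, N`; the initial guess `U 0` is arbitrary (of class `C²`). -/
structure IsSchwarzIteration (k σ δ L H : ℝ) (N : ℕ) (a₁ : ℝ) (f : ℝ → ℝ → ℂ) (g₁ g₂ : ℝ → ℂ)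
    (U : ℕ → ℕ → ℝ → ℝ → ℂ) : Prop where
  initial_smooth : ∀ j ∈ Set.Icc 1 N, ContDiff ℝ 2 (fun z : ℝ × ℝ => U 0 j z.1 z.2)
  interior : ∀ n, ∀ j ∈ Set.Icc 1 N,
    SolvesInStrip k σ H f (leftEnd a₁ L j) (rightEnd a₁ L δ j) (U (n + 1) j)
  left_transmission : ∀ n, ∀ j ∈ Set.Icc 2 N, ∀ y ∈ Set.Ioo 0 H,
    robinLeft (impedance k) (U (n + 1) j) (leftEnd a₁ L j) y
      = robinLeft (impedance k) (U n (j - 1)) (leftEnd a₁ L j) y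
  right_transmission : ∀ n, ∀ j ∈ Set.Ico 1 N, ∀ y ∈ Set.Ioo 0 H,
    robinRight (impedance k) (U (n + 1) j) (rightEnd a₁ L δ j) y
      = robinRight (impedance k) (U n (j + 1)) (rightEnd a₁ L δ j) y
  left_end : ∀ n, ∀ y ∈ Set.Ioo 0 H,
    robinLeft (impedance k) (U (n + 1) 1) (leftEnd a₁ L 1) y = g₁ y
  right_end : ∀ n, ∀ y ∈ Set.Ioo 0 H,
    robinRight (impedance k) (U (n + 1) N) (rightEnd a₁ L δ N) y = g₂ y

/-! ### Fourier sine modes and the iteration matrix of a mode -/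

/-- The Fourier number `m π / H`. -/
def fourierNumber (H : ℝ) (m : ℕ) : ℝ := m * Real.pi / H

/-- The `m`-th Fourier sine coefficient on `(0, H)`. -/
def sineCoeff (H : ℝ) (m : ℕ) (φ : ℝ → ℂ) : ℂ :=
  (2 / H : ℝ) * ∫ y in (0 : ℝ)..H, φ y * (Real.sin (fourierNumber H m * y) : ℂ)

/-- The `m`-th Fourier mode of the Robin interface data
`[R₊(b₁), R₋(a₂), R₊(b₂), R₋(a₃), …, R₊(b_{N-1}), R₋(a_N)]` of local errors `e 1, …, e N`, where
`R₊(b_j)` is the right Robin trace of `e (j + 1)` at `b_j` and `R₋(a_{j+1})` is the left Robin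
trace of `e j` at `a_{j+1}`. Block `i : Fin (N - 1)` holds these two values for `j = i + 1`. -/
def interfaceData (k δ L H : ℝ) (N : ℕ) (a₁ : ℝ) (m : ℕ) (e : ℕ → ℝ → ℝ → ℂ) :
    Fin (N - 1) × Fin 2 → ℂ := fun s =>
  if s.2 = 0 then
    sineCoeff H m (fun y =>
      robinRight (impedance k) (e ((s.1 : ℕ) + 2)) (rightEnd a₁ L δ ((s.1 : ℕ) + 1)) y)
  else
    sineCoeff H m (fun y =>
      robinLeft (impedance k) (e ((s.1 : ℕ) + 1)) (leftEnd a₁ L ((s.1 : ℕ) + 2)) y)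

/-- `T` propagates the `m`-th Fourier mode of the Robin interface data of the local errors
`e_j^n = u - U n j` from every iteration of the parallel Schwarz method to the next one. -/
def IsModeIterationMatrix (k σ δ L H : ℝ) (N m : ℕ)
    (T : Matrix (Fin (N - 1) × Fin 2) (Fin (N - 1) × Fin 2) ℂ) : Prop :=
  ∀ (a₁ : ℝ) (f : ℝ → ℝ → ℂ) (g₁ g₂ : ℝ → ℂ) (u : ℝ → ℝ → ℂ) (U : ℕ → ℕ → ℝ → ℝ → ℂ),
    IsWaveguideSolution k σ δ L H N a₁ f g₁ g₂ u →
    IsSchwarzIteration k σ δ L H N a₁ f g₁ g₂ U →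
    ∀ n : ℕ,
      interfaceData k δ L H N a₁ m (fun j x y => u x y - U (n + 1) j x y)
        = T *ᵥ interfaceData k δ L H N a₁ m (fun j x y => u x y - U n j x y)

/-- The block Toeplitz matrix with `M × M` blocks of size `2 × 2`: diagonal blocks
`[[0, b], [b, 0]]`, superdiagonal blocks `[[a, 0], [0, 0]]`, subdiagonal blocks `[[0, 0], [0, a]]`,
and zero elsewhere. -/
def blockToeplitz (a b : ℂ) (M : ℕ) : Matrix (Fin M × Fin 2) (Fin M × Fin 2) ℂ := fun s t =>
  if (t.1 : ℕ) = s.1 then !![0, b; b, 0] s.2 t.2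
  else if (t.1 : ℕ) = s.1 + 1 then !![a, 0; 0, 0] s.2 t.2
  else if (s.1 : ℕ) = t.1 + 1 then !![0, 0; 0, a] s.2 t.2
  else 0

/-- Common denominator of the two entries of the iteration matrix. -/
def denomCoeff (ζ α : ℂ) (δ L : ℝ) : ℂ :=
  (ζ + α) ^ 2 * Complex.exp (ζ * (2 * δ + L)) - (ζ - α) ^ 2 * Complex.exp (-ζ * (2 * δ + L))

/-- The entry `a` of the iteration matrix. -/
def aCoeff (ζ α : ℂ) (δ L : ℝ) : ℂ :=
  ((ζ + α) ^ 2 * Complex.exp (2 * ζ * δ) - (ζ - α) ^ 2 * Complex.exp (-2 * ζ * δ))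
    / denomCoeff ζ α δ L

/-- The entry `b` of the iteration matrix. -/
def bCoeff (ζ α : ℂ) (δ L : ℝ) : ℂ :=
  -((ζ ^ 2 - α ^ 2) * (Complex.exp (ζ * L) - Complex.exp (-ζ * L))) / denomCoeff ζ α δ L

/-- `ζ(κ) = √(i k σ + κ² - k²)` (principal branch) for the Fourier number `κ`. -/
def zeta (k σ κ : ℝ) : ℂ :=
  (Complex.I * k * σ + (κ : ℂ) ^ 2 - (k : ℂ) ^ 2) ^ (1 / 2 : ℂ)

/-- The iteration matrix for the Fourier number `κ` and `N` subdomains, with `α = i k`. -/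
def iterMatrix (k σ δ L κ : ℝ) (N : ℕ) :
    Matrix (Fin (N - 1) × Fin 2) (Fin (N - 1) × Fin 2) ℂ :=
  blockToeplitz (aCoeff (zeta k σ κ) (impedance k) δ L) (bCoeff (zeta k σ κ) (impedance k) δ L)
    (N - 1)

/-! ### Convergence factors -/

/-- The limiting convergence factor of the Fourier number `κ`: the limit of the spectral radius of
the iteration matrix as the number of subdomains tends to infinity. -/
def factor1d (k σ δ L κ : ℝ) : ENNReal :=
  limUnder atTop (fun N : ℕ => spectralRadius ℂ (iterMatrix k σ δ L κ N))

/-- The supremum of the limiting convergence factors over all Fourier numbers `m π / H`, `m ≥ 1`. -/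
def factor2d (k σ δ L H : ℝ) : ENNReal :=
  ⨆ (m : ℕ) (_ : 1 ≤ m), factor1d k σ δ L (fourierNumber H m)

end Waveguide

end

noncomputable section

namespace Waveguide

/-! The error in a strip solves the homogeneous problem, so its sine coefficient satisfies `v'' = ζ²
v` and is a combination of two exponentials. Eliminating the two constants expresses the Robin
traces at the two inner interface points through those at the strip ends, with coefficients `a` and
`b` (`SolvesInStrip.transmission`); this is the iteration matrix. It is unique because every vector
occurs as initial interface data (`exists_isSchwarzIteration`).

Spectral radius: regrouped by strips, the matrix is a truncated shift of the normal blocks [[a, b],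
[b, a]], whose eigenvalues are `a ± b`; hence `ρ ≤ max |a ± b|` for every size. Conversely, if `b ≠
0`, sine-shaped eigenvectors and the implicit function theorem give eigenvalues converging to `a ±
b`. The limit is therefore `max |a ± b|`, and it also bounds every finite `ρ`, which yields the
scaling statement.

Contraction: put `B = e^{ζL}` and let `s` be the damped reflection coefficient. Then `a ± b = (1 ∓
sB)/(B ∓ s)`, and `|B - s|² - |1 - sB|² = (|B|² - 1)(1 - |s|²) - 4 Im s Im B`. With `x = Re ζ` and
`y = Im ζ`, the bounds `|sin t| ≤ t ≤ sinh t` for `t ≥ 0` turn positivity into algebraic conditions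
on `x`, `y`, where `x² - y² = κ² - k²` and `2xy = kσ`. For `κ ≥ k` one has `y ≤ x`; for `σ ≥ k` one
has `|ζ| ≥ k`; otherwise `σ ≥ ε` bounds `x` below and `y` above uniformly, so a large `δ` or `L`
suffices. For large `κ` the factor is at most `1/2`, so only finitely many modes matter for the
supremum and strictness survives. -/

/-! ### Upper bound for the spectral radius of the block Toeplitz matrices -/

theorem mem_spectrum_iff_exists_mulVec {n : Type*} [Fintype n] [DecidableEq n]
    (A : Matrix n n ℂ) (μ : ℂ) :
    μ ∈ spectrum ℂ A ↔ ∃ v : n → ℂ, v ≠ 0 ∧ A *ᵥ v = μ • v := by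
  rw [spectrum.mem_iff, Matrix.isUnit_iff_isUnit_det, isUnit_iff_ne_zero, not_not,
    ← Matrix.exists_mulVec_eq_zero_iff]
  refine exists_congr fun v => and_congr_right fun _ => ?_
  rw [Matrix.sub_mulVec, sub_eq_zero, Algebra.algebraMap_eq_smul_one, Matrix.smul_mulVec,
    Matrix.one_mulVec, eq_comm]

/-- The vector with entries `R i` and `L (i + 1)` in block `i`. -/
def interleave (M : ℕ) (R L : ℕ → ℂ) : Fin M × Fin 2 → ℂ := fun s =>
  if s.2 = 0 then R s.1 else L (s.1 + 1)

/-- The closing values `R M = 0` and `L 0 = 0` give the first and last block rows the form of the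
interior ones. The second sequence is only read at positive indices, so the truncated `i - 1` is
harmless. -/
theorem blockToeplitz_mulVec_interleave (a b : ℂ) (M : ℕ) (R L : ℕ → ℂ) (hR : R M = 0)
    (hL : L 0 = 0) :
    blockToeplitz a b M *ᵥ interleave M R L
      = interleave M (fun i => b * L (i + 1) + a * R (i + 1))
          (fun i => b * R (i - 1) + a * L (i - 1)) := by
  ext ⟨i, p⟩
  simp only [Matrix.mulVec, dotProduct, Fintype.sum_prod_type, Fin.sum_univ_two]
  fin_cases p
  · have h : ∀ t : Fin M, blockToeplitz a b M (i, 0) (t, 0) * interleave M R L (t, 0)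
        + blockToeplitz a b M (i, 0) (t, 1) * interleave M R L (t, 1)
        = (fun t : ℕ => (if i + 1 = t then a * R t else 0)
          + (if (i : ℕ) = t then b * L (t + 1) else 0)) t := by
      intro t
      simp only [blockToeplitz, interleave, if_true, one_ne_zero, if_false]
      split_ifs <;> first | (exfalso; omega) | simp
    simp only [Fin.zero_eta, h]
    rw [Fin.sum_univ_eq_sum_range (fun t : ℕ => (if (i : ℕ) + 1 = t then a * R t else 0)
          + (if (i : ℕ) = t then b * L (t + 1) else 0)) M, Finset.sum_add_distrib,
      Finset.sum_ite_eq, Finset.sum_ite_eq]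
    have : a * R (i + 1) = if (i : ℕ) + 1 ∈ Finset.range M then a * R (i + 1) else 0 := by
      split_ifs with h1
      · rfl
      · have : (i : ℕ) + 1 = M := by have := i.2; simp at h1; omega
        rw [this, hR, mul_zero]
    rw [← this]
    simp [interleave, add_comm]
  · have h : ∀ t : Fin M, blockToeplitz a b M (i, 1) (t, 0) * interleave M R L (t, 0)
        + blockToeplitz a b M (i, 1) (t, 1) * interleave M R L (t, 1)
        = (fun t : ℕ => (if (i : ℕ) = t then b * R t else 0)
          + (if (i : ℕ) = t + 1 then a * L (t + 1) else 0)) t := by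
      intro t
      simp only [blockToeplitz, interleave, if_true, one_ne_zero, if_false]
      split_ifs <;> first | (exfalso; omega) | simp
    simp only [Fin.mk_one, h]
    rw [Fin.sum_univ_eq_sum_range (fun t : ℕ => (if (i : ℕ) = t then b * R t else 0)
          + (if (i : ℕ) = t + 1 then a * L (t + 1) else 0)) M, Finset.sum_add_distrib,
      Finset.sum_ite_eq]
    have : a * L i = ∑ t ∈ Finset.range M, if (i : ℕ) = t + 1 then a * L (t + 1) else 0 := by
      rcases hi : (i : ℕ) with _ | j
      · simp [hL]
      · have : j < M := by have := i.2; omega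
        simp [this]
    rw [← this]
    simp [interleave]

theorem exists_interleave (M : ℕ) (v : Fin M × Fin 2 → ℂ) :
    ∃ R L : ℕ → ℂ, R M = 0 ∧ L 0 = 0 ∧ v = interleave M R L := by
  refine ⟨fun i => if h : i < M then v (⟨i, h⟩, 0) else 0,
    fun i => if h : 0 < i ∧ i - 1 < M then v (⟨i - 1, h.2⟩, 1) else 0, by simp, by simp, ?_⟩
  ext ⟨i, p⟩
  fin_cases p <;> simp [interleave]

theorem sum_norm_sq_interleave (M : ℕ) (R L : ℕ → ℂ) :
    ∑ s, ‖interleave M R L s‖ ^ 2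
      = ∑ i ∈ Finset.range M, (‖R i‖ ^ 2 + ‖L (i + 1)‖ ^ 2) := by
  simp only [Fintype.sum_prod_type, Fin.sum_univ_two]
  rw [← Fin.sum_univ_eq_sum_range (fun i => ‖R i‖ ^ 2 + ‖L (i + 1)‖ ^ 2)]
  simp [interleave]

/-- The block [[a, b], [b, a]] is diagonal in the coordinates `x + y` and `x - y`, with eigenvalues
`a ± b`; the parallelogram law says that this change of coordinates is orthogonal up to scaling. -/
theorem norm_sq_add_norm_sq_le (a b x y : ℂ) {C : ℝ} (h₁ : ‖a + b‖ ≤ C) (h₂ : ‖a - b‖ ≤ C) :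
    ‖b * x + a * y‖ ^ 2 + ‖b * y + a * x‖ ^ 2 ≤ C ^ 2 * (‖x‖ ^ 2 + ‖y‖ ^ 2) := by
  have p₁ := parallelogram_law_with_norm ℝ (b * x + a * y) (b * y + a * x)
  have p₂ := parallelogram_law_with_norm ℝ x y
  have e₁ : b * x + a * y + (b * y + a * x) = (a + b) * (x + y) := by ring
  have e₂ : b * x + a * y - (b * y + a * x) = -((a - b) * (x - y)) := by ring
  rw [e₁, e₂, norm_neg, norm_mul, norm_mul] at p₁
  have i₁ : ‖a + b‖ * ‖x + y‖ ≤ C * ‖x + y‖ := by gcongr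
  have i₂ : ‖a - b‖ * ‖x - y‖ ≤ C * ‖x - y‖ := by gcongr
  have j₁ := mul_self_le_mul_self (by positivity) i₁
  have j₂ := mul_self_le_mul_self (by positivity) i₂
  nlinarith

/-- The eigenvalues of a truncated block Toeplitz matrix are bounded by `max |a ± b|`. -/
theorem norm_le_of_mem_spectrum_blockToeplitz {a b : ℂ} {M : ℕ} {μ : ℂ}
    (hμ : μ ∈ spectrum ℂ (blockToeplitz a b M)) : ‖μ‖ ≤ max ‖a + b‖ ‖a - b‖ := by
  obtain ⟨v, hv, h⟩ := (mem_spectrum_iff_exists_mulVec _ _).1 hμ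
  obtain ⟨R, L, hR, hL, rfl⟩ := exists_interleave M v
  set C := max ‖a + b‖ ‖a - b‖
  have hC : 0 ≤ C := le_max_of_le_left (norm_nonneg _)
  have hpos : 0 < ∑ s, ‖interleave M R L s‖ ^ 2 := by
    obtain ⟨s, hs⟩ := Function.ne_iff.1 hv
    refine Finset.sum_pos' (fun _ _ => by positivity) ⟨s, Finset.mem_univ _, ?_⟩
    have := norm_pos_iff.2 hs
    positivity
  have key : ∑ s, ‖(blockToeplitz a b M *ᵥ interleave M R L) s‖ ^ 2
      ≤ C ^ 2 * ∑ s, ‖interleave M R L s‖ ^ 2 := by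
    rw [blockToeplitz_mulVec_interleave _ _ _ _ _ hR hL, sum_norm_sq_interleave,
      sum_norm_sq_interleave]
    -- Regroup by strips: `(L i, R i)` for `0 ≤ i ≤ M` instead of `(R i, L (i + 1))`. The two added
    -- entries vanish, and each new pair is acted on by one block [[a, b], [b, a]].
    have hsum : ∑ i ∈ Finset.range M, (‖R i‖ ^ 2 + ‖L (i + 1)‖ ^ 2)
        = ∑ i ∈ Finset.range (M + 1), (‖L i‖ ^ 2 + ‖R i‖ ^ 2) := by
      rw [Finset.sum_add_distrib, Finset.sum_add_distrib, Finset.sum_range_succ' (fun i => ‖L i‖ ^ 2),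
        Finset.sum_range_succ (fun i => ‖R i‖ ^ 2), hR, hL]
      simp [add_comm]
    rw [hsum, Finset.mul_sum]
    refine le_trans ?_ (Finset.sum_le_sum fun i _ =>
      norm_sq_add_norm_sq_le a b (L i) (R i) (le_max_left _ _) (le_max_right _ _))
    rw [Finset.sum_add_distrib, Finset.sum_add_distrib,
      Finset.sum_range_succ' (fun i => ‖b * L i + a * R i‖ ^ 2),
      Finset.sum_range_succ (fun i => ‖b * R i + a * L i‖ ^ 2)]
    simp only [Nat.add_sub_cancel]
    -- The outputs at the two outer ends are not entries of the product; discarding them only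
    -- decreases the norm.
    have h1 : 0 ≤ ‖b * L 0 + a * R 0‖ ^ 2 := by positivity
    have h2 : 0 ≤ ‖b * R M + a * L M‖ ^ 2 := by positivity
    linarith
  rw [h] at key
  simp only [Pi.smul_apply, smul_eq_mul, norm_mul, mul_pow, ← Finset.mul_sum] at key
  exact abs_le_of_sq_le_sq' (le_of_mul_le_mul_right key hpos) hC |>.2

theorem spectralRadius_blockToeplitz_le (a b : ℂ) (M : ℕ) :
    spectralRadius ℂ (blockToeplitz a b M) ≤ ENNReal.ofReal (max ‖a + b‖ ‖a - b‖) := by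
  refine iSup₂_le fun μ hμ => ?_
  have := norm_le_of_mem_spectrum_blockToeplitz hμ
  rw [← enorm_eq_nnnorm, ← ofReal_norm]
  exact ENNReal.ofReal_le_ofReal this

/-! ### Eigenvalues accumulating at `a ± b` -/

/-- Eliminating `L` from the eigenvalue equations leaves a three-term recurrence for `R` with
constant coefficients. Its solution with `R M = 0` is `sin ((M - i) θ)`, `h₁` being the dispersion
relation; `h₂` is the remaining closing condition `L 0 = 0`. -/
theorem mem_spectrum_blockToeplitz_of_sin {a b μ θ : ℂ} {M : ℕ} (hM : 1 ≤ M) (hb : b ≠ 0)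
    (hθ : Complex.sin θ ≠ 0) (h₁ : μ ^ 2 + a ^ 2 - b ^ 2 = 2 * a * μ * Complex.cos θ)
    (h₂ : μ * Complex.sin ((M + 1) * θ) = a * Complex.sin (M * θ)) :
    μ ∈ spectrum ℂ (blockToeplitz a b M) := by
  rw [mem_spectrum_iff_exists_mulVec]
  set S : ℕ → ℂ := fun i => Complex.sin ((M - i : ℂ) * θ) with hS
  set L : ℕ → ℂ := fun j => (μ * Complex.sin ((M + 1 - j : ℂ) * θ) - a * S j) / b with hLdef
  have hSM : S M = 0 := by simp [hS]
  have hL0 : L 0 = 0 := by simp [hLdef, hS, h₂]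
  refine ⟨interleave M S L, fun h0 => hθ ?_, ?_⟩
  -- The last `R` entry is `sin θ`, so the vector is nonzero.
  · have := congrFun h0 (⟨M - 1, by omega⟩, 0)
    simpa [interleave, hS, Nat.cast_sub hM] using this
  · rw [blockToeplitz_mulVec_interleave _ _ _ _ _ hSM hL0]
    have e₁ : ∀ i, b * L (i + 1) + a * S (i + 1) = μ * S i := by
      intro i
      have : ((M : ℂ) + 1 - ((i + 1 : ℕ) : ℂ)) * θ = (M - i) * θ := by push_cast; ring
      simp only [hLdef, this]
      field_simp
      simp [hS]
    have e₂ : ∀ i, b * S i + a * L i = μ * L (i + 1) := by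
      intro i
      have t₀ : ((M : ℂ) + 1 - ((i + 1 : ℕ) : ℂ)) * θ = (M - i) * θ := by push_cast; ring
      have t₁ : ((M : ℂ) + 1 - i) * θ = (M - i) * θ + θ := by ring
      have t₂ : ((M : ℂ) - ((i + 1 : ℕ) : ℂ)) * θ = (M - i) * θ - θ := by push_cast; ring
      simp only [hLdef, hS, t₀, t₁, t₂, Complex.sin_add, Complex.sin_sub]
      field_simp
      linear_combination -Complex.sin ((M - i : ℂ) * θ) * h₁
    ext ⟨i, p⟩
    fin_cases p
    · simp [interleave, e₁]
    · simp [interleave, e₂]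

/-- Eigenvalues of the truncated block Toeplitz matrices accumulate at `a + c` if `c = ± b ≠ 0`. -/
theorem exists_tendsto_mem_spectrum_blockToeplitz {a b c : ℂ} (hc : c ≠ 0) (hcb : c ^ 2 = b ^ 2) :
    ∃ μ : ℕ → ℂ, Tendsto μ atTop (𝓝 (a + c)) ∧
      ∀ᶠ M in atTop, μ M ∈ spectrum ℂ (blockToeplitz a b M) := by
  have hb : b ≠ 0 := by
    rintro rfl
    exact hc (by simpa using hcb)
  -- The dispersion relation is quadratic in `μ`, with roots `a cos θ ± √(b² - a² sin² θ)`.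
  -- Factoring `c` out of the root makes the principal branch analytic near `θ = 0` with value `1`,
  -- which selects the root `Λ` tending to `a + c`.
  set q : ℂ → ℂ := fun θ => (1 - (a / c) ^ 2 * Complex.sin θ ^ 2) ^ (1 / 2 : ℂ) with hq
  set Λ : ℂ → ℂ := fun θ => a * Complex.cos θ + c * q θ with hΛ
  have hq0 : q 0 = 1 := by simp [hq]
  have hq2 : ∀ θ, q θ ^ 2 = 1 - (a / c) ^ 2 * Complex.sin θ ^ 2 := by
    intro θ
    simp only [hq]
    rw [one_div]
    exact Complex.cpow_ofNat_inv_pow _ 2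
  have hΛ0 : Λ 0 = a + c := by simp [hΛ, hq0]
  have hqa : AnalyticAt ℂ q 0 := by
    refine AnalyticAt.cpow ?_ analyticAt_const (by simp)
    exact analyticAt_const.sub (analyticAt_const.mul (Complex.analyticAt_sin.pow 2))
  have hΛa : AnalyticAt ℂ Λ 0 :=
    (analyticAt_const.mul Complex.analyticAt_cos).add (analyticAt_const.mul hqa)
  have hΛeq : ∀ θ, Λ θ ^ 2 + a ^ 2 - b ^ 2 = 2 * a * Λ θ * Complex.cos θ := by
    intro θ
    have h1 : c ^ 2 * q θ ^ 2 = c ^ 2 - a ^ 2 * Complex.sin θ ^ 2 := by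
      rw [hq2]; field_simp
    simp only [hΛ]
    linear_combination h1 + hcb - a ^ 2 * Complex.sin_sq_add_cos_sq θ
  -- The closing condition in the variables `s = 1 / (M + 1)` and `t = (M + 1) θ`, so that `θ = s t`
  -- and `M θ = t - s t`. At `s = 0` it is `c sin t = 0`, with the simple zero `t = π`, which
  -- continues to small `s`.
  set G : ℂ × ℂ → ℂ := fun z =>
    Λ (z.1 * z.2) * Complex.sin z.2 - a * Complex.sin (z.2 - z.1 * z.2) with hG
  set u : ℂ × ℂ := (0, Real.pi) with hu
  have hmul : AnalyticAt ℂ (fun z : ℂ × ℂ => z.1 * z.2) u := analyticAt_fst.mul analyticAt_snd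
  have hGa : AnalyticAt ℂ G u := by
    have h1 : AnalyticAt ℂ (fun z : ℂ × ℂ => Λ (z.1 * z.2)) u :=
      AnalyticAt.fun_comp (by simpa [hu] using hΛa) hmul
    have h2 : AnalyticAt ℂ (fun z : ℂ × ℂ => Complex.sin z.2) u := Complex.analyticAt_sin.fun_comp analyticAt_snd
    have h3 : AnalyticAt ℂ (fun z : ℂ × ℂ => Complex.sin (z.2 - z.1 * z.2)) u :=
      Complex.analyticAt_sin.fun_comp (analyticAt_snd.sub hmul)
    exact (h1.mul h2).sub (analyticAt_const.mul h3)
  have hGs : HasStrictFDerivAt G (fderiv ℂ G u) u := hGa.hasStrictFDerivAt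
  have hpart : (fderiv ℂ G u) ∘L (ContinuousLinearMap.inr ℂ ℂ ℂ)
      = ContinuousLinearMap.toSpanSingleton ℂ (-c) := by
    have h1 : HasFDerivAt (fun t : ℂ => G (0, t))
        ((fderiv ℂ G u) ∘L (ContinuousLinearMap.inr ℂ ℂ ℂ)) (Real.pi : ℂ) :=
      HasFDerivAt.comp (Real.pi : ℂ) hGs.hasFDerivAt (hasFDerivAt_prodMk_right (0 : ℂ) (Real.pi : ℂ))
    have h2 : HasDerivAt (fun t : ℂ => G (0, t)) (-c) (Real.pi : ℂ) := by
      have : (fun t : ℂ => G (0, t)) = fun t => c * Complex.sin t := by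
        ext t; simp [hG, hΛ0]; ring
      rw [this]
      simpa [← Complex.ofReal_cos] using (Complex.hasDerivAt_sin (Real.pi : ℂ)).const_mul c
    exact h1.unique h2.hasFDerivAt
  have hinv : ((fderiv ℂ G u) ∘L (ContinuousLinearMap.inr ℂ ℂ ℂ)).IsInvertible := by
    rw [hpart]
    refine ⟨ContinuousLinearEquiv.unitsEquivAut ℂ (Units.mk0 (-c) (neg_ne_zero.2 hc)), ?_⟩
    ext
    simp
  set ψ := hGs.implicitFunctionOfProdDomain hinv
  have hψ : Tendsto ψ (𝓝 0) (𝓝 (Real.pi : ℂ)) := hGs.tendsto_implicitFunctionOfProdDomain hinv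
  have hψ0 : ∀ᶠ s in 𝓝 (0 : ℂ), G (s, ψ s) = 0 := by
    have := hGs.eventually_apply_implicitFunctionOfProdDomain hinv
    have hGu : G u = 0 := by simp [hG, hu, ← Complex.ofReal_sin]
    rwa [hGu] at this
  set s : ℕ → ℂ := fun M => 1 / ((M : ℂ) + 1) with hs
  have hs0 : Tendsto s atTop (𝓝 0) := tendsto_one_div_add_atTop_nhds_zero_nat
  have hsne : ∀ M, s M ≠ 0 := fun M => one_div_ne_zero (Nat.cast_add_one_ne_zero M)
  have hθ : Tendsto (fun M => s M * ψ (s M)) atTop (𝓝 0) := by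
    simpa using hs0.mul (hψ.comp hs0)
  have hψne : ∀ᶠ M in atTop, ψ (s M) ≠ 0 :=
    (hψ.comp hs0).eventually_ne (by exact_mod_cast Real.pi_ne_zero)
  -- The angles tend to `0` but are eventually nonzero, and `0` is an isolated zero of the sine.
  have hsin : ∀ᶠ M in atTop, Complex.sin (s M * ψ (s M)) ≠ 0 := by
    have h1 : ∀ᶠ θ in 𝓝[≠] (0 : ℂ), Complex.sin θ ≠ 0 := by
      have := (Complex.hasDerivAt_sin 0).eventually_ne (c := 0) (by simp)
      simpa using this
    refine (tendsto_nhdsWithin_iff.2 ⟨hθ, ?_⟩).eventually h1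
    filter_upwards [hψne] with M hM using mul_ne_zero (hsne M) hM
  refine ⟨fun M => Λ (s M * ψ (s M)), ?_, ?_⟩
  · rw [← hΛ0]
    exact hΛa.continuousAt.tendsto.comp hθ
  · filter_upwards [hsin, hs0.eventually hψ0, eventually_ge_atTop 1] with M h1 h2 hM
    refine mem_spectrum_blockToeplitz_of_sin hM hb h1 (hΛeq _) ?_
    have hM1 : (M : ℂ) + 1 ≠ 0 := Nat.cast_add_one_ne_zero M
    have e1 : ((M : ℂ) + 1) * (s M * ψ (s M)) = ψ (s M) := by
      simp only [hs]; field_simp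
    have e2 : (M : ℂ) * (s M * ψ (s M)) = ψ (s M) - s M * ψ (s M) := by
      linear_combination e1
    rw [e1, e2]
    exact sub_eq_zero.1 h2

/-- The hypothesis `b ≠ 0` cannot be dropped: for `b = 0` the matrices are nilpotent, whereas the
bound is `‖a‖`. -/
theorem tendsto_spectralRadius_blockToeplitz {a b : ℂ} (hb : b ≠ 0) :
    Tendsto (fun M => spectralRadius ℂ (blockToeplitz a b M)) atTop
      (𝓝 (ENNReal.ofReal (max ‖a + b‖ ‖a - b‖))) := by
  obtain ⟨c, hc, hcb, hmax⟩ : ∃ c : ℂ, c ≠ 0 ∧ c ^ 2 = b ^ 2 ∧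
      max ‖a + b‖ ‖a - b‖ = ‖a + c‖ := by
    rcases le_total ‖a - b‖ ‖a + b‖ with h | h
    · exact ⟨b, hb, rfl, max_eq_left h⟩
    · exact ⟨-b, neg_ne_zero.2 hb, by ring, by rw [max_eq_right h, sub_eq_add_neg]⟩
  obtain ⟨μ, hμ, hspec⟩ := exists_tendsto_mem_spectrum_blockToeplitz (a := a) hc hcb
  have hlow : Tendsto (fun M => ‖μ M‖ₑ) atTop (𝓝 (ENNReal.ofReal (max ‖a + b‖ ‖a - b‖))) := by
    rw [hmax, ofReal_norm]
    exact hμ.enorm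
  refine tendsto_of_tendsto_of_tendsto_of_le_of_le' hlow tendsto_const_nhds ?_
    (Eventually.of_forall fun M => spectralRadius_blockToeplitz_le a b M)
  filter_upwards [hspec] with M hM
  exact le_iSup₂ (f := fun k (_ : k ∈ spectrum ℂ (blockToeplitz a b M)) => (‖k‖₊ : ENNReal)) _ hM

/-! ### The principal square root -/

theorem zeta_sq (k σ κ : ℝ) :
    zeta k σ κ ^ 2 = Complex.I * k * σ + (κ : ℂ) ^ 2 - (k : ℂ) ^ 2 := by
  rw [zeta, one_div]
  exact Complex.cpow_ofNat_inv_pow _ 2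

theorem zeta_sq_re (k σ κ : ℝ) :
    (zeta k σ κ).re ^ 2 - (zeta k σ κ).im ^ 2 = κ ^ 2 - k ^ 2 := by
  have := congrArg Complex.re (zeta_sq k σ κ)
  simp [pow_two] at this
  linarith

theorem two_mul_zeta_re_mul_zeta_im (k σ κ : ℝ) :
    2 * (zeta k σ κ).re * (zeta k σ κ).im = k * σ := by
  have := congrArg Complex.im (zeta_sq k σ κ)
  simp [pow_two] at this
  linarith

/-- Absorption keeps the radicand off the negative real axis, so half of its argument lies strictly
between `-π/2` and `π/2`. -/
theorem zeta_re_pos {k σ : ℝ} (hk : 0 < k) (hσ : 0 < σ) (κ : ℝ) : 0 < (zeta k σ κ).re := by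
  set w : ℂ := Complex.I * k * σ + (κ : ℂ) ^ 2 - (k : ℂ) ^ 2 with hw
  have him : w.im = k * σ := by simp [hw, pow_two]
  have hw0 : w ≠ 0 := fun h => by
    rw [h] at him
    exact (mul_pos hk hσ).ne him
  have hz : zeta k σ κ = Complex.exp (Complex.log w * (1 / 2)) := by
    rw [zeta, Complex.cpow_def_of_ne_zero hw0]
  have h1 : (Complex.log w * (1 / 2)).im = w.arg / 2 := by
    have : (1 / 2 : ℂ) = ((1 / 2 : ℝ) : ℂ) := by push_cast; rfl
    rw [this, Complex.im_mul_ofReal, Complex.log_im]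
    ring
  rw [hz, Complex.exp_re, h1]
  have hlt : w.arg < Real.pi := by
    refine lt_of_le_of_ne (Complex.arg_le_pi w) fun h => ?_
    have := (Complex.arg_eq_pi_iff.1 h).2
    exact (mul_pos hk hσ).ne' (him ▸ this)
  have hgt := Complex.neg_pi_lt_arg w
  exact mul_pos (Real.exp_pos _) (Real.cos_pos_of_mem_Ioo ⟨by linarith, by linarith⟩)

theorem zeta_im_pos {k σ : ℝ} (hk : 0 < k) (hσ : 0 < σ) (κ : ℝ) : 0 < (zeta k σ κ).im := by
  have h := two_mul_zeta_re_mul_zeta_im k σ κ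
  have h1 := zeta_re_pos hk hσ κ
  have h2 : 0 < 2 * (zeta k σ κ).re * (zeta k σ κ).im := h ▸ mul_pos hk hσ
  exact (mul_pos_iff_of_pos_left (by positivity)).1 h2

/-! ### The entries of the iteration matrix in terms of the reflection coefficient -/

/-- The reflection coefficient `(ζ - α) / (ζ + α)`, damped over the overlap `2 δ`. -/
def dampedReflection (ζ α : ℂ) (δ : ℝ) : ℂ :=
  (ζ - α) / (ζ + α) * Complex.exp (-2 * ζ * δ)

section Reflection

variable {ζ : ℂ} {k δ L : ℝ}

theorem add_impedance_ne_zero (hx : 0 < ζ.re) : ζ + impedance k ≠ 0 := fun h => by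
  have := congrArg Complex.re h
  simp [impedance] at this
  exact hx.ne' this

theorem normSq_add_impedance (ζ : ℂ) (k : ℝ) :
    Complex.normSq (ζ + impedance k) = ζ.re ^ 2 + (ζ.im + k) ^ 2 := by
  simp [impedance, Complex.normSq_apply]; ring

theorem normSq_sub_impedance (ζ : ℂ) (k : ℝ) :
    Complex.normSq (ζ - impedance k) = ζ.re ^ 2 + (ζ.im - k) ^ 2 := by
  simp [impedance, Complex.normSq_apply]; ring

theorem normSq_dampedReflection (ζ : ℂ) (k δ : ℝ) :
    Complex.normSq (dampedReflection ζ (impedance k) δ)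
      = (ζ.re ^ 2 + (ζ.im - k) ^ 2) / (ζ.re ^ 2 + (ζ.im + k) ^ 2)
        * Real.exp (-(ζ.re * (2 * δ))) ^ 2 := by
  rw [dampedReflection, Complex.normSq_mul, Complex.normSq_div, normSq_add_impedance,
    normSq_sub_impedance, Complex.normSq_eq_norm_sq, Complex.norm_exp]
  congr 3
  simp
  ring

theorem im_dampedReflection (ζ : ℂ) (k δ : ℝ) :
    (dampedReflection ζ (impedance k) δ).im
      = -(2 * k * ζ.re * Real.cos (ζ.im * (2 * δ))
          + (ζ.re ^ 2 + ζ.im ^ 2 - k ^ 2) * Real.sin (ζ.im * (2 * δ)))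
        / (ζ.re ^ 2 + (ζ.im + k) ^ 2) * Real.exp (-(ζ.re * (2 * δ))) := by
  have e : -2 * ζ * δ = ((-(ζ.re * (2 * δ)) : ℝ) : ℂ) + ((-(ζ.im * (2 * δ)) : ℝ) : ℂ) * Complex.I := by
    apply Complex.ext <;> simp <;> ring
  have h1 : (Complex.exp (-2 * ζ * δ)).re
      = Real.exp (-(ζ.re * (2 * δ))) * Real.cos (ζ.im * (2 * δ)) := by
    rw [e, Complex.exp_re]; simp
  have h2 : (Complex.exp (-2 * ζ * δ)).im
      = -(Real.exp (-(ζ.re * (2 * δ))) * Real.sin (ζ.im * (2 * δ))) := by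
    rw [e, Complex.exp_im]; simp
  rw [dampedReflection, Complex.mul_im, h1, h2, Complex.div_re, Complex.div_im,
    normSq_add_impedance]
  simp [impedance]
  ring

/-- Since `Im ζ` and `k` are positive, `ζ` is closer to `ik` than to `-ik`; the undamped reflection
coefficient has modulus at most `1`. -/
theorem norm_dampedReflection_le (hx : 0 < ζ.re) (hy : 0 < ζ.im) (hk : 0 < k) :
    ‖dampedReflection ζ (impedance k) δ‖ ≤ Real.exp (-(ζ.re * (2 * δ))) := by
  refine abs_le_of_sq_le_sq' ?_ (Real.exp_pos _).le |>.2
  rw [← Complex.normSq_eq_norm_sq, normSq_dampedReflection]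
  refine mul_le_of_le_one_left (by positivity) ?_
  rw [div_le_one (by positivity)]
  nlinarith [mul_pos hy hk]

theorem norm_dampedReflection_lt_one (hx : 0 < ζ.re) (hy : 0 < ζ.im) (hk : 0 < k) (hδ : 0 < δ) :
    ‖dampedReflection ζ (impedance k) δ‖ < 1 := by
  refine (norm_dampedReflection_le hx hy hk).trans_lt ?_
  rw [Real.exp_lt_one_iff]
  have : 0 < ζ.re * (2 * δ) := by positivity
  linarith

theorem norm_exp_mul_ofReal (ζ : ℂ) (L : ℝ) : ‖Complex.exp (ζ * L)‖ = Real.exp (ζ.re * L) := by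
  rw [Complex.norm_exp]; simp

theorem one_lt_norm_exp_mul (hx : 0 < ζ.re) (hL : 0 < L) : 1 < ‖Complex.exp (ζ * L)‖ := by
  rw [norm_exp_mul_ofReal, Real.one_lt_exp_iff]
  positivity

theorem sq_sub_sq_ne_zero {s B : ℂ} (hs : ‖s‖ < 1) (hB : 1 < ‖B‖) : B ^ 2 - s ^ 2 ≠ 0 := fun h => by
  have h1 := congrArg norm (sub_eq_zero.1 h)
  rw [norm_pow, norm_pow] at h1
  have := norm_nonneg s
  nlinarith

theorem denomCoeff_eq (hx : 0 < ζ.re) :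
    denomCoeff ζ (impedance k) δ L
      = (ζ + impedance k) ^ 2 * Complex.exp (2 * ζ * δ) / Complex.exp (ζ * L)
        * (Complex.exp (ζ * L) ^ 2 - dampedReflection ζ (impedance k) δ ^ 2) := by
  have hp := add_impedance_ne_zero (k := k) hx
  have e1 : ζ * (2 * δ + L) = 2 * ζ * δ + ζ * L := by ring
  have e2 : -ζ * (2 * δ + L) = -(2 * ζ * δ) - ζ * L := by ring
  have e3 : -2 * ζ * δ = -(2 * ζ * δ) := by ring
  rw [denomCoeff, dampedReflection, e1, e2, e3, Complex.exp_add, Complex.exp_sub, Complex.exp_neg]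
  have h1 := Complex.exp_ne_zero (2 * ζ * δ)
  have h2 := Complex.exp_ne_zero (ζ * L)
  field_simp

theorem denomCoeff_ne_zero (hx : 0 < ζ.re) (hy : 0 < ζ.im) (hk : 0 < k) (hδ : 0 < δ) (hL : 0 < L) :
    denomCoeff ζ (impedance k) δ L ≠ 0 := by
  rw [denomCoeff_eq hx]
  refine mul_ne_zero (div_ne_zero (mul_ne_zero (pow_ne_zero _ (add_impedance_ne_zero hx))
    (Complex.exp_ne_zero _)) (Complex.exp_ne_zero _)) ?_
  exact sq_sub_sq_ne_zero (norm_dampedReflection_lt_one hx hy hk hδ) (one_lt_norm_exp_mul hx hL)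

theorem aCoeff_eq (hx : 0 < ζ.re) :
    aCoeff ζ (impedance k) δ L
      = Complex.exp (ζ * L) * (1 - dampedReflection ζ (impedance k) δ ^ 2)
        / (Complex.exp (ζ * L) ^ 2 - dampedReflection ζ (impedance k) δ ^ 2) := by
  have hp := add_impedance_ne_zero (k := k) hx
  have h1 := Complex.exp_ne_zero (2 * ζ * δ)
  have h2 := Complex.exp_ne_zero (ζ * L)
  have hn : (ζ + impedance k) ^ 2 * Complex.exp (2 * ζ * δ)
      - (ζ - impedance k) ^ 2 * Complex.exp (-2 * ζ * δ)
      = (ζ + impedance k) ^ 2 * Complex.exp (2 * ζ * δ) / Complex.exp (ζ * L)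
        * (Complex.exp (ζ * L) * (1 - dampedReflection ζ (impedance k) δ ^ 2)) := by
    have e3 : -2 * ζ * δ = -(2 * ζ * δ) := by ring
    rw [dampedReflection, e3, Complex.exp_neg]
    field_simp
  rw [aCoeff, hn, denomCoeff_eq hx, mul_div_mul_left]
  exact div_ne_zero (mul_ne_zero (pow_ne_zero _ hp) h1) h2

theorem bCoeff_eq (hx : 0 < ζ.re) :
    bCoeff ζ (impedance k) δ L
      = -(dampedReflection ζ (impedance k) δ * (Complex.exp (ζ * L) ^ 2 - 1))
        / (Complex.exp (ζ * L) ^ 2 - dampedReflection ζ (impedance k) δ ^ 2) := by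
  have hp := add_impedance_ne_zero (k := k) hx
  have h1 := Complex.exp_ne_zero (2 * ζ * δ)
  have h2 := Complex.exp_ne_zero (ζ * L)
  have hn : -((ζ ^ 2 - impedance k ^ 2) * (Complex.exp (ζ * L) - Complex.exp (-ζ * L)))
      = (ζ + impedance k) ^ 2 * Complex.exp (2 * ζ * δ) / Complex.exp (ζ * L)
        * -(dampedReflection ζ (impedance k) δ * (Complex.exp (ζ * L) ^ 2 - 1)) := by
    have e3 : -2 * ζ * δ = -(2 * ζ * δ) := by ring
    rw [dampedReflection, e3, neg_mul ζ, Complex.exp_neg, Complex.exp_neg]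
    field_simp
    ring
  rw [bCoeff, hn, denomCoeff_eq hx, mul_div_mul_left]
  exact div_ne_zero (mul_ne_zero (pow_ne_zero _ hp) h1) h2

/-- The numerator factors as `(B + s)(1 - sB)`, and `B + s` cancels against the denominator `B² -
s²`. -/
theorem aCoeff_add_bCoeff (hx : 0 < ζ.re) (hy : 0 < ζ.im) (hk : 0 < k) (hδ : 0 < δ) (hL : 0 < L) :
    aCoeff ζ (impedance k) δ L + bCoeff ζ (impedance k) δ L
      = (1 - dampedReflection ζ (impedance k) δ * Complex.exp (ζ * L))
        / (Complex.exp (ζ * L) - dampedReflection ζ (impedance k) δ) := by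
  have h := sq_sub_sq_ne_zero (norm_dampedReflection_lt_one hx hy hk hδ) (one_lt_norm_exp_mul hx hL)
  rw [aCoeff_eq hx, bCoeff_eq hx]
  rw [sq_sub_sq] at h ⊢
  have h1 := left_ne_zero_of_mul h
  have h2 := right_ne_zero_of_mul h
  field_simp
  ring

theorem aCoeff_sub_bCoeff (hx : 0 < ζ.re) (hy : 0 < ζ.im) (hk : 0 < k) (hδ : 0 < δ) (hL : 0 < L) :
    aCoeff ζ (impedance k) δ L - bCoeff ζ (impedance k) δ L
      = (1 + dampedReflection ζ (impedance k) δ * Complex.exp (ζ * L))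
        / (Complex.exp (ζ * L) + dampedReflection ζ (impedance k) δ) := by
  have h := sq_sub_sq_ne_zero (norm_dampedReflection_lt_one hx hy hk hδ) (one_lt_norm_exp_mul hx hL)
  rw [aCoeff_eq hx, bCoeff_eq hx]
  rw [sq_sub_sq] at h ⊢
  have h1 := left_ne_zero_of_mul h
  have h2 := right_ne_zero_of_mul h
  field_simp
  ring

/-! ### The contraction criterion for a single mode -/

/-- The hypothesis is exactly positivity of `|B - s|² - |1 - sB|²`, expanded in real and imaginary
parts. -/
theorem norm_one_sub_mul_div_lt_one {s B : ℂ}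
    (h : 4 * (s.im * B.im) < (Complex.normSq B - 1) * (1 - Complex.normSq s)) :
    ‖(1 - s * B) / (B - s)‖ < 1 := by
  have h1 : ‖1 - s * B‖ ^ 2 < ‖B - s‖ ^ 2 := by
    rw [← Complex.normSq_eq_norm_sq, ← Complex.normSq_eq_norm_sq]
    simp only [Complex.normSq_apply, Complex.sub_re, Complex.sub_im, Complex.mul_re,
      Complex.mul_im, Complex.one_re, Complex.one_im] at h ⊢
    linarith
  have h2 : ‖1 - s * B‖ < ‖B - s‖ := lt_of_pow_lt_pow_left₀ 2 (norm_nonneg _) h1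
  rw [norm_div, div_lt_one ((norm_nonneg _).trans_lt h2)]
  exact h2

/-- The criterion for the contraction of a Fourier mode. -/
theorem norm_aCoeff_add_sub_bCoeff_lt_one (hx : 0 < ζ.re) (hy : 0 < ζ.im) (hk : 0 < k) (hδ : 0 < δ)
    (hL : 0 < L)
    (h : |2 * k * ζ.re * Real.cos (ζ.im * (2 * δ))
          + (ζ.re ^ 2 + ζ.im ^ 2 - k ^ 2) * Real.sin (ζ.im * (2 * δ))| * |Real.sin (ζ.im * L)|
        < Real.sinh (ζ.re * L) * ((ζ.re ^ 2 + ζ.im ^ 2 + k ^ 2) * Real.sinh (ζ.re * (2 * δ))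
          + 2 * k * ζ.im * Real.cosh (ζ.re * (2 * δ)))) :
    max ‖aCoeff ζ (impedance k) δ L + bCoeff ζ (impedance k) δ L‖
      ‖aCoeff ζ (impedance k) δ L - bCoeff ζ (impedance k) δ L‖ < 1 := by
  rw [aCoeff_add_bCoeff hx hy hk hδ hL, aCoeff_sub_bCoeff hx hy hk hδ hL]
  set s := dampedReflection ζ (impedance k) δ with hs
  set B := Complex.exp (ζ * L) with hB
  have key : 4 * |s.im * B.im| < (Complex.normSq B - 1) * (1 - Complex.normSq s) := by
    have hBim : B.im = Real.exp (ζ.re * L) * Real.sin (ζ.im * L) := by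
      rw [hB, Complex.exp_im]; simp
    have hBn : Complex.normSq B - 1 = 2 * Real.exp (ζ.re * L) * Real.sinh (ζ.re * L) := by
      rw [Complex.normSq_eq_norm_sq, hB, norm_exp_mul_ofReal, Real.sinh_eq, Real.exp_neg]
      field_simp
    rw [hBn, hBim, hs, im_dampedReflection, normSq_dampedReflection]
    set Δ := ζ.re ^ 2 + (ζ.im + k) ^ 2 with hΔ
    have hΔ0 : 0 < Δ := by positivity
    rw [abs_mul, abs_mul, abs_mul, abs_div, abs_neg, Real.abs_exp, Real.abs_exp, abs_of_pos hΔ0]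
    have e : 1 - (ζ.re ^ 2 + (ζ.im - k) ^ 2) / Δ * Real.exp (-(ζ.re * (2 * δ))) ^ 2
        = 2 * Real.exp (-(ζ.re * (2 * δ))) / Δ
          * ((ζ.re ^ 2 + ζ.im ^ 2 + k ^ 2) * Real.sinh (ζ.re * (2 * δ))
          + 2 * k * ζ.im * Real.cosh (ζ.re * (2 * δ))) := by
      rw [Real.sinh_eq, Real.cosh_eq, Real.exp_neg]
      have := Real.exp_pos (ζ.re * (2 * δ))
      field_simp
      rw [hΔ]
      ring
    rw [e]
    -- Both sides of the goal are the corresponding sides of `h` times this common factor.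
    have hc : 0 < 4 * Real.exp (-(ζ.re * (2 * δ))) * Real.exp (ζ.re * L) / Δ := by positivity
    have := mul_lt_mul_of_pos_left h hc
    exact (le_of_eq (by ring)).trans_lt (this.trans_le (le_of_eq (by ring)))
  rw [max_lt_iff]
  constructor
  · refine norm_one_sub_mul_div_lt_one (lt_of_le_of_lt ?_ key)
    linarith [le_abs_self (s.im * B.im)]
  -- Passing from `a + b` to `a - b` replaces `s` by `-s`; the absolute value in `key` covers both
  -- signs.
  · have := norm_one_sub_mul_div_lt_one (s := -s) (B := B) ?_
    · simpa using this
    · rw [Complex.normSq_neg, Complex.neg_im]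
      refine lt_of_le_of_lt ?_ key
      linarith [neg_abs_le (s.im * B.im)]

theorem norm_aCoeff_add_sub_bCoeff_le_half (hx : 0 < ζ.re) (hy : 0 < ζ.im) (hk : 0 < k) (hδ : 0 < δ)
    (hL : 0 < L) (h₁ : 8 ≤ ζ.re * L) (h₂ : 8 ≤ ζ.re * (2 * δ)) :
    max ‖aCoeff ζ (impedance k) δ L + bCoeff ζ (impedance k) δ L‖
      ‖aCoeff ζ (impedance k) δ L - bCoeff ζ (impedance k) δ L‖ ≤ 1 / 2 := by
  rw [aCoeff_add_bCoeff hx hy hk hδ hL, aCoeff_sub_bCoeff hx hy hk hδ hL]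
  have hs := norm_dampedReflection_le (δ := δ) hx hy hk
  have hBn := norm_exp_mul_ofReal ζ L
  set s := dampedReflection ζ (impedance k) δ
  set B := Complex.exp (ζ * L)
  have hB8 : 8 ≤ ‖B‖ := by
    rw [hBn]; linarith [Real.add_one_le_exp (ζ.re * L)]
  have hs8 : ‖s‖ ≤ 1 / 8 := by
    refine hs.trans ?_
    rw [Real.exp_neg, one_div]
    exact inv_anti₀ (by norm_num) (by linarith [Real.add_one_le_exp (ζ.re * (2 * δ))])
  have gen : ∀ s : ℂ, ‖s‖ ≤ 1 / 8 → ‖(1 - s * B) / (B - s)‖ ≤ 1 / 2 := by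
    intro s hs
    have i1 : ‖1 - s * B‖ ≤ 1 + ‖s‖ * ‖B‖ := by
      simpa using norm_sub_le (1 : ℂ) (s * B)
    have i2 : ‖B‖ - ‖s‖ ≤ ‖B - s‖ := norm_sub_norm_le B s
    have i3 : ‖s‖ * ‖B‖ ≤ 1 / 8 * ‖B‖ := by gcongr
    rw [norm_div, div_le_iff₀ (by linarith)]
    linarith
  refine max_le (gen s hs8) ?_
  simpa using gen (-s) (by rwa [norm_neg])

/-! ### Sufficient conditions for contraction -/

/-- The bounds `|sin (yL)| ≤ yL` and `xL < sinh (xL)` remove `L` from the criterion. The cosine term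
is then absorbed by the `cosh` term, both carrying the factor `2kxy`; what remains is `h`. -/
theorem contraction_of_overlap (hx : 0 < ζ.re) (hy : 0 < ζ.im) (hk : 0 < k) (hδ : 0 < δ)
    (hL : 0 < L)
    (h : ζ.im * (|ζ.re ^ 2 + ζ.im ^ 2 - k ^ 2| * |Real.sin (ζ.im * (2 * δ))|)
      ≤ ζ.re * ((ζ.re ^ 2 + ζ.im ^ 2 + k ^ 2) * Real.sinh (ζ.re * (2 * δ)))) :
    max ‖aCoeff ζ (impedance k) δ L + bCoeff ζ (impedance k) δ L‖
      ‖aCoeff ζ (impedance k) δ L - bCoeff ζ (impedance k) δ L‖ < 1 := by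
  refine norm_aCoeff_add_sub_bCoeff_lt_one hx hy hk hδ hL ?_
  have hsinh : 0 < Real.sinh (ζ.re * (2 * δ)) := Real.sinh_pos_iff.2 (by positivity)
  have hcosh := Real.one_le_cosh (ζ.re * (2 * δ))
  set W := (ζ.re ^ 2 + ζ.im ^ 2 + k ^ 2) * Real.sinh (ζ.re * (2 * δ))
          + 2 * k * ζ.im * Real.cosh (ζ.re * (2 * δ)) with hW
  have hW0 : 0 < W := by
    have := Real.cosh_pos (ζ.re * (2 * δ))
    positivity
  set V := |2 * k * ζ.re * Real.cos (ζ.im * (2 * δ))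
          + (ζ.re ^ 2 + ζ.im ^ 2 - k ^ 2) * Real.sin (ζ.im * (2 * δ))| with hV
  have hVle : V ≤ 2 * k * ζ.re + |ζ.re ^ 2 + ζ.im ^ 2 - k ^ 2| * |Real.sin (ζ.im * (2 * δ))| := by
    refine (abs_add_le _ _).trans ?_
    rw [abs_mul _ (Real.sin _), abs_mul _ (Real.cos _), abs_of_pos (by positivity : 0 < 2 * k * ζ.re)]
    have := Real.abs_cos_le_one (ζ.im * (2 * δ))
    have : 2 * k * ζ.re * |Real.cos (ζ.im * (2 * δ))| ≤ 2 * k * ζ.re :=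
      mul_le_of_le_one_right (by positivity) this
    linarith
  have hVW : ζ.im * V ≤ ζ.re * W := by
    have h1 := mul_le_mul_of_nonneg_left hVle hy.le
    have h2 : 2 * k * ζ.im * ζ.re * 1 ≤ 2 * k * ζ.im * ζ.re * Real.cosh (ζ.re * (2 * δ)) := by gcongr
    rw [hW]
    nlinarith
  have hsin : |Real.sin (ζ.im * L)| ≤ ζ.im * L := by
    simpa [abs_of_pos (mul_pos hy hL)] using Real.abs_sin_le_abs (x := ζ.im * L)
  calc V * |Real.sin (ζ.im * L)| ≤ V * (ζ.im * L) := by gcongr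
    _ = L * (ζ.im * V) := by ring
    _ ≤ L * (ζ.re * W) := by gcongr
    _ = ζ.re * L * W := by ring
    _ < Real.sinh (ζ.re * L) * W := by
      gcongr
      exact Real.self_lt_sinh_iff.2 (by positivity)

theorem contraction_of_sq_le (hx : 0 < ζ.re) (hy : 0 < ζ.im) (hk : 0 < k) (hδ : 0 < δ)
    (hL : 0 < L)
    (h : ζ.im ^ 2 * |ζ.re ^ 2 + ζ.im ^ 2 - k ^ 2| ≤ ζ.re ^ 2 * (ζ.re ^ 2 + ζ.im ^ 2 + k ^ 2)) :
    max ‖aCoeff ζ (impedance k) δ L + bCoeff ζ (impedance k) δ L‖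
      ‖aCoeff ζ (impedance k) δ L - bCoeff ζ (impedance k) δ L‖ < 1 := by
  refine contraction_of_overlap hx hy hk hδ hL ?_
  have h1 : |Real.sin (ζ.im * (2 * δ))| ≤ ζ.im * (2 * δ) := by
    simpa [abs_of_pos (by positivity : 0 < ζ.im * (2 * δ))] using
      Real.abs_sin_le_abs (x := ζ.im * (2 * δ))
  have h2 : ζ.re * (2 * δ) ≤ Real.sinh (ζ.re * (2 * δ)) := Real.self_le_sinh_iff.2 (by positivity)
  calc ζ.im * (|ζ.re ^ 2 + ζ.im ^ 2 - k ^ 2| * |Real.sin (ζ.im * (2 * δ))|)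
      ≤ ζ.im * (|ζ.re ^ 2 + ζ.im ^ 2 - k ^ 2| * (ζ.im * (2 * δ))) := by gcongr
    _ = 2 * δ * (ζ.im ^ 2 * |ζ.re ^ 2 + ζ.im ^ 2 - k ^ 2|) := by ring
    _ ≤ 2 * δ * (ζ.re ^ 2 * (ζ.re ^ 2 + ζ.im ^ 2 + k ^ 2)) := by gcongr
    _ = ζ.re * ((ζ.re ^ 2 + ζ.im ^ 2 + k ^ 2) * (ζ.re * (2 * δ))) := by ring
    _ ≤ _ := by gcongr

theorem abs_normSq_sub_le (x y k : ℝ) : |x ^ 2 + y ^ 2 - k ^ 2| ≤ x ^ 2 + y ^ 2 + k ^ 2 := by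
  rw [abs_le]
  constructor <;> nlinarith [sq_nonneg x, sq_nonneg y, sq_nonneg k]

theorem contraction_of_im_le_re (hx : 0 < ζ.re) (hy : 0 < ζ.im) (hk : 0 < k) (hδ : 0 < δ)
    (hL : 0 < L) (h : ζ.im ≤ ζ.re) :
    max ‖aCoeff ζ (impedance k) δ L + bCoeff ζ (impedance k) δ L‖
      ‖aCoeff ζ (impedance k) δ L - bCoeff ζ (impedance k) δ L‖ < 1 := by
  refine contraction_of_sq_le hx hy hk hδ hL ?_
  have := abs_normSq_sub_le ζ.re ζ.im k
  gcongr

/-- Without the absolute value, the condition of `contraction_of_sq_le` reads `(y² - x²)|ζ|² ≤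
k²|ζ|²`. -/
theorem contraction_of_le_norm (hx : 0 < ζ.re) (hy : 0 < ζ.im) (hk : 0 < k) (hδ : 0 < δ)
    (hL : 0 < L) (h₁ : k ^ 2 ≤ ζ.re ^ 2 + ζ.im ^ 2) (h₂ : ζ.im ^ 2 - ζ.re ^ 2 ≤ k ^ 2) :
    max ‖aCoeff ζ (impedance k) δ L + bCoeff ζ (impedance k) δ L‖
      ‖aCoeff ζ (impedance k) δ L - bCoeff ζ (impedance k) δ L‖ < 1 := by
  refine contraction_of_sq_le hx hy hk hδ hL ?_
  rw [abs_of_nonneg (by linarith)]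
  nlinarith [sq_nonneg ζ.re, sq_nonneg ζ.im]

theorem contraction_of_large_overlap (hx : 0 < ζ.re) (hy : 0 < ζ.im) (hk : 0 < k) (hδ : 0 < δ)
    (hL : 0 < L) (h : ζ.im ≤ ζ.re ^ 2 * (2 * δ)) :
    max ‖aCoeff ζ (impedance k) δ L + bCoeff ζ (impedance k) δ L‖
      ‖aCoeff ζ (impedance k) δ L - bCoeff ζ (impedance k) δ L‖ < 1 := by
  refine contraction_of_overlap hx hy hk hδ hL ?_
  have h1 := Real.abs_sin_le_one (ζ.im * (2 * δ))
  have h2 : ζ.re * (2 * δ) ≤ Real.sinh (ζ.re * (2 * δ)) := Real.self_le_sinh_iff.2 (by positivity)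
  have h3 := abs_normSq_sub_le ζ.re ζ.im k
  calc ζ.im * (|ζ.re ^ 2 + ζ.im ^ 2 - k ^ 2| * |Real.sin (ζ.im * (2 * δ))|)
      ≤ ζ.re ^ 2 * (2 * δ) * ((ζ.re ^ 2 + ζ.im ^ 2 + k ^ 2) * 1) := by gcongr
    _ = ζ.re * ((ζ.re ^ 2 + ζ.im ^ 2 + k ^ 2) * (ζ.re * (2 * δ))) := by ring
    _ ≤ _ := by gcongr

/-- Here `sin (yL)` is bounded by `1` and only the `cosh` term is kept, which is bounded below
however small `δ` is. -/
theorem contraction_of_large_width (hx : 0 < ζ.re) (hy : 0 < ζ.im) (hk : 0 < k) (hδ : 0 < δ)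
    (hL : 0 < L)
    (h : 2 * k * ζ.re + |ζ.re ^ 2 + ζ.im ^ 2 - k ^ 2| < ζ.re * L * (2 * k * ζ.im)) :
    max ‖aCoeff ζ (impedance k) δ L + bCoeff ζ (impedance k) δ L‖
      ‖aCoeff ζ (impedance k) δ L - bCoeff ζ (impedance k) δ L‖ < 1 := by
  refine norm_aCoeff_add_sub_bCoeff_lt_one hx hy hk hδ hL ?_
  have hsinh : 0 < Real.sinh (ζ.re * (2 * δ)) := Real.sinh_pos_iff.2 (by positivity)
  have hcosh := Real.one_le_cosh (ζ.re * (2 * δ))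
  have hself : ζ.re * L ≤ Real.sinh (ζ.re * L) := Real.self_le_sinh_iff.2 (by positivity)
  calc |2 * k * ζ.re * Real.cos (ζ.im * (2 * δ))
          + (ζ.re ^ 2 + ζ.im ^ 2 - k ^ 2) * Real.sin (ζ.im * (2 * δ))| * |Real.sin (ζ.im * L)|
      ≤ (2 * k * ζ.re * 1 + |ζ.re ^ 2 + ζ.im ^ 2 - k ^ 2| * 1) * 1 := by
        gcongr
        · refine (abs_add_le _ _).trans ?_
          rw [abs_mul _ (Real.sin _), abs_mul _ (Real.cos _),
            abs_of_pos (by positivity : 0 < 2 * k * ζ.re)]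
          gcongr
          · exact Real.abs_cos_le_one _
          · exact Real.abs_sin_le_one _
        · exact Real.abs_sin_le_one _
    _ < ζ.re * L * (2 * k * ζ.im) := by linarith
    _ ≤ Real.sinh (ζ.re * L) * (0 + 2 * k * ζ.im * 1) := by
      rw [zero_add, mul_one]; gcongr
    _ ≤ _ := by gcongr; positivity

end Reflection

/-! ### Convergence factors -/

section Factors

variable {k σ δ L κ H : ℝ}

theorem bCoeff_zeta_ne_zero (hk : 0 < k) (hσ : 0 < σ) (hδ : 0 < δ) (hL : 0 < L) :
    bCoeff (zeta k σ κ) (impedance k) δ L ≠ 0 := by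
  have hx := zeta_re_pos hk hσ κ
  have hy := zeta_im_pos hk hσ κ
  have hB := one_lt_norm_exp_mul hx hL
  rw [bCoeff_eq hx]
  refine div_ne_zero (neg_ne_zero.2 (mul_ne_zero ?_ ?_))
    (sq_sub_sq_ne_zero (norm_dampedReflection_lt_one hx hy hk hδ) hB)
  · refine mul_ne_zero (div_ne_zero (fun h => ?_) (add_impedance_ne_zero hx)) (Complex.exp_ne_zero _)
    have := congrArg Complex.re h
    simp [impedance] at this
    exact hx.ne' this
  · intro h
    have h1 := congrArg norm (sub_eq_zero.1 h)
    rw [norm_pow, norm_one] at h1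
    nlinarith

theorem tendsto_spectralRadius_iterMatrix (hk : 0 < k) (hσ : 0 < σ) (hδ : 0 < δ) (hL : 0 < L) :
    Tendsto (fun N : ℕ => spectralRadius ℂ (iterMatrix k σ δ L κ N)) atTop
      (𝓝 (ENNReal.ofReal
        (max ‖aCoeff (zeta k σ κ) (impedance k) δ L + bCoeff (zeta k σ κ) (impedance k) δ L‖
          ‖aCoeff (zeta k σ κ) (impedance k) δ L - bCoeff (zeta k σ κ) (impedance k) δ L‖))) :=
  (tendsto_spectralRadius_blockToeplitz (bCoeff_zeta_ne_zero hk hσ hδ hL)).comp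
    (tendsto_sub_atTop_nat 1)

theorem factor1d_eq (hk : 0 < k) (hσ : 0 < σ) (hδ : 0 < δ) (hL : 0 < L) :
    factor1d k σ δ L κ = ENNReal.ofReal
      (max ‖aCoeff (zeta k σ κ) (impedance k) δ L + bCoeff (zeta k σ κ) (impedance k) δ L‖
        ‖aCoeff (zeta k σ κ) (impedance k) δ L - bCoeff (zeta k σ κ) (impedance k) δ L‖) :=
  (tendsto_spectralRadius_iterMatrix hk hσ hδ hL).limUnder_eq

theorem spectralRadius_iterMatrix_le_factor1d (hk : 0 < k) (hσ : 0 < σ) (hδ : 0 < δ) (hL : 0 < L)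
    (N : ℕ) : spectralRadius ℂ (iterMatrix k σ δ L κ N) ≤ factor1d k σ δ L κ := by
  rw [factor1d_eq hk hσ hδ hL]
  exact spectralRadius_blockToeplitz_le _ _ _

theorem factor1d_lt_one_of_le (hk : 0 < k) (hσ : 0 < σ) (hδ : 0 < δ) (hL : 0 < L) (hκ : k ≤ κ) :
    factor1d k σ δ L κ < 1 := by
  rw [factor1d_eq hk hσ hδ hL, ENNReal.ofReal_lt_one]
  have hx := zeta_re_pos hk hσ κ
  refine contraction_of_im_le_re hx (zeta_im_pos hk hσ κ) hk hδ hL ?_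
  refine abs_le_of_sq_le_sq' ?_ hx.le |>.2
  nlinarith [zeta_sq_re k σ κ]

theorem factor1d_lt_one_of_absorption (hk : 0 < k) (hδ : 0 < δ) (hL : 0 < L) (hσ : k ≤ σ) :
    factor1d k σ δ L κ < 1 := by
  have hσ0 : 0 < σ := hk.trans_le hσ
  rw [factor1d_eq hk hσ0 hδ hL, ENNReal.ofReal_lt_one]
  have hre := zeta_sq_re k σ κ
  have him := two_mul_zeta_re_mul_zeta_im k σ κ
  have hx := zeta_re_pos hk hσ0 κ
  have hy := zeta_im_pos hk hσ0 κ
  refine contraction_of_le_norm hx hy hk hδ hL ?_ (by nlinarith [sq_nonneg κ])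
  nlinarith [sq_nonneg ((zeta k σ κ).re - (zeta k σ κ).im)]

theorem factor1d_lt_one_of_large {ε : ℝ} (hk : 0 < k) (hε : 0 < ε) (hσ : ε ≤ σ) (hδ : 0 < δ)
    (hL : 0 < L) (hκ : 0 < κ)
    (h : k ≤ σ ∨ 32 * k / ε ^ 2 ≤ δ ∨ 6 / ε ≤ L) : factor1d k σ δ L κ < 1 := by
  have hσ0 : 0 < σ := hε.trans_le hσ
  rcases le_or_gt k κ with hκk | hκk
  · exact factor1d_lt_one_of_le hk hσ0 hδ hL hκk
  rcases le_or_gt k σ with hσk | hσk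
  · exact factor1d_lt_one_of_absorption hk hδ hL hσk
  rw [factor1d_eq hk hσ0 hδ hL, ENNReal.ofReal_lt_one]
  have hre := zeta_sq_re k σ κ
  have him := two_mul_zeta_re_mul_zeta_im k σ κ
  have hx := zeta_re_pos hk hσ0 κ
  have hy := zeta_im_pos hk hσ0 κ
  set x := (zeta k σ κ).re
  set y := (zeta k σ κ).im
  -- In the remaining range `κ, σ < k`, both parts of `ζ²` are at most `k²` in modulus, so `|ζ|⁴ ≤
  -- 2k⁴`.
  have hnorm : x ^ 2 + y ^ 2 ≤ 2 * k ^ 2 := by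
    have h1 : (x ^ 2 + y ^ 2) ^ 2 = (x ^ 2 - y ^ 2) ^ 2 + (2 * x * y) ^ 2 := by ring
    have h2 : (x ^ 2 - y ^ 2) ^ 2 ≤ (k ^ 2) ^ 2 := by
      refine sq_le_sq' ?_ ?_ <;> nlinarith
    have h3 : (2 * x * y) ^ 2 ≤ (k ^ 2) ^ 2 := by
      rw [him]
      exact pow_le_pow_left₀ (by positivity) (by nlinarith) 2
    refine abs_le_of_sq_le_sq' ?_ (by positivity) |>.2
    nlinarith [sq_nonneg (k ^ 2)]
  have hx2 : x ≤ 2 * k := abs_le_of_sq_le_sq' (by nlinarith) (by positivity) |>.2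
  have hy2 : y ≤ 2 * k := abs_le_of_sq_le_sq' (by nlinarith) (by positivity) |>.2
  -- From `2xy = kσ ≥ kε` and `y ≤ 2k`; this is where the lower bound on the absorption enters.
  have hx4 : ε / 4 ≤ x := by
    by_contra hlt
    have h1 : 2 * x * y < 2 * (ε / 4) * (2 * k) := by
      have := not_le.1 hlt
      calc 2 * x * y ≤ 2 * x * (2 * k) := by gcongr
        _ < 2 * (ε / 4) * (2 * k) := by gcongr
    nlinarith
  rcases h with h | h | h
  · exact absurd h (not_le.2 hσk)
  · refine contraction_of_large_overlap hx hy hk hδ hL (hy2.trans ?_)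
    rw [div_le_iff₀ (by positivity)] at h
    calc 2 * k ≤ (ε / 4) ^ 2 * (2 * δ) := by nlinarith
      _ ≤ x ^ 2 * (2 * δ) := by gcongr
  · refine contraction_of_large_width hx hy hk hδ hL ?_
    rw [div_le_iff₀ hε] at h
    -- The left side of the width condition is at most `4k² + k²`, the right side equals `k²Lσ ≥
    -- 6k²`; hence the threshold `6 / ε`.
    have h1 : |x ^ 2 + y ^ 2 - k ^ 2| ≤ k ^ 2 := abs_le.2 ⟨by nlinarith, by linarith⟩
    have h2 : x * L * (2 * k * y) = k * (k * (L * σ)) := by linear_combination k * L * him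
    have h3 : 6 ≤ L * σ := h.trans (by gcongr)
    rw [h2]
    have h4 : k * (k * 6) ≤ k * (k * (L * σ)) := by gcongr
    have h5 : 2 * k * x ≤ 2 * k * (2 * k) := by gcongr
    nlinarith

theorem factor1d_le_half (hk : 0 < k) (hσ : 0 < σ) (hδ : 0 < δ) (hL : 0 < L)
    (hκ : k + (8 / L + 8 / δ) ≤ κ) : factor1d k σ δ L κ ≤ ENNReal.ofReal (1 / 2) := by
  rw [factor1d_eq hk hσ hδ hL]
  have hx := zeta_re_pos hk hσ κ
  have hre := zeta_sq_re k σ κ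
  have hL8 : 0 < 8 / L := by positivity
  have hδ8 : 0 < 8 / δ := by positivity
  -- `(Re ζ)² ≥ κ² - k² ≥ (κ - k)²`.
  have hX : 8 / L + 8 / δ ≤ (zeta k σ κ).re := by
    refine abs_le_of_sq_le_sq' ?_ hx.le |>.2
    nlinarith [sq_nonneg (zeta k σ κ).im]
  refine ENNReal.ofReal_le_ofReal
    (norm_aCoeff_add_sub_bCoeff_le_half hx (zeta_im_pos hk hσ κ) hk hδ hL ?_ ?_)
  · rw [← div_le_iff₀ hL]; linarith
  · rw [← div_le_iff₀ (by positivity)]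
    have : 8 / (2 * δ) ≤ 8 / δ := by gcongr; linarith
    linarith

theorem fourierNumber_pos (hH : 0 < H) {m : ℕ} (hm : 1 ≤ m) : 0 < fourierNumber H m := by
  have : (0 : ℝ) < m := by exact_mod_cast hm
  have := Real.pi_pos
  unfold fourierNumber
  positivity

theorem tendsto_fourierNumber (hH : 0 < H) : Tendsto (fourierNumber H) atTop atTop :=
  (tendsto_natCast_atTop_atTop.atTop_mul_const Real.pi_pos).atTop_div_const hH

/-- As `factor1d` decays for large Fourier numbers, the supremum over all modes is less than one as
soon as every mode contracts. -/
theorem factor2d_lt_one (hk : 0 < k) (hσ : 0 < σ) (hδ : 0 < δ) (hL : 0 < L) (hH : 0 < H)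
    (h : ∀ κ, 0 < κ → factor1d k σ δ L κ < 1) : factor2d k σ δ L H < 1 := by
  obtain ⟨m₀, hm₀⟩ := eventually_atTop.1
    ((tendsto_fourierNumber hH).eventually_ge_atTop (k + (8 / L + 8 / δ)))
  have hle : factor2d k σ δ L H ≤ max (ENNReal.ofReal (1 / 2))
      ((Finset.Icc 1 m₀).sup fun m => factor1d k σ δ L (fourierNumber H m)) := by
    refine iSup₂_le fun m hm => ?_
    rcases le_total m₀ m with hmm | hmm
    · exact le_max_of_le_left (factor1d_le_half hk hσ hδ hL (hm₀ m hmm))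
    · exact le_max_of_le_right (Finset.le_sup (f := fun m => factor1d k σ δ L (fourierNumber H m))
        (Finset.mem_Icc.2 ⟨hm, hmm⟩))
  refine hle.trans_lt (max_lt ?_ ?_)
  · rw [ENNReal.ofReal_lt_one]; norm_num
  · rw [Finset.sup_lt_iff (by simp)]
    intro m hm
    exact h _ (fourierNumber_pos hH (Finset.mem_Icc.1 hm).1)

end Factors

/-! ### Partial derivatives of smooth functions on the plane -/

section Smooth

variable {w w₁ w₂ : ℝ → ℝ → ℂ}

theorem contDiff_slice_left {n : WithTop ℕ∞} (hw : ContDiff ℝ n fun z : ℝ × ℝ => w z.1 z.2) (y : ℝ) :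
    ContDiff ℝ n fun s => w s y :=
  hw.comp (contDiff_id.prodMk contDiff_const)

theorem contDiff_slice_right {n : WithTop ℕ∞} (hw : ContDiff ℝ n fun z : ℝ × ℝ => w z.1 z.2)
    (x : ℝ) : ContDiff ℝ n fun s => w x s :=
  hw.comp (contDiff_const.prodMk contDiff_id)

theorem hasDerivAt_dx (hw : ContDiff ℝ 1 fun z : ℝ × ℝ => w z.1 z.2) (x y : ℝ) :
    HasDerivAt (fun s => w s y) (dx w x y) x :=
  ((contDiff_slice_left hw y).differentiable one_ne_zero x).hasDerivAt

theorem dx_eq_fderiv (hw : ContDiff ℝ 1 fun z : ℝ × ℝ => w z.1 z.2) (x y : ℝ) :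
    dx w x y = fderiv ℝ (fun z : ℝ × ℝ => w z.1 z.2) (x, y) (1, 0) := by
  have h1 := (hw.differentiable one_ne_zero (x, y)).hasFDerivAt
  have h2 : HasDerivAt (fun s : ℝ => (s, y)) ((1 : ℝ), (0 : ℝ)) x :=
    (hasDerivAt_id x).prodMk (hasDerivAt_const x y)
  exact (h1.comp_hasDerivAt x h2).deriv

theorem contDiff_dx {n : ℕ} (hw : ContDiff ℝ (n + 1 : ℕ) fun z : ℝ × ℝ => w z.1 z.2) :
    ContDiff ℝ n fun z : ℝ × ℝ => dx w z.1 z.2 := by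
  have h1 : ContDiff ℝ 1 fun z : ℝ × ℝ => w z.1 z.2 := hw.of_le (by exact_mod_cast Nat.le_add_left 1 n)
  have : (fun z : ℝ × ℝ => dx w z.1 z.2)
      = fun z => fderiv ℝ (fun z : ℝ × ℝ => w z.1 z.2) z (1, 0) := by
    ext z; exact dx_eq_fderiv h1 z.1 z.2
  rw [this]
  exact (hw.fderiv_right (m := n) (by push_cast; rfl)).clm_apply contDiff_const

theorem dx_sub (h₁ : ContDiff ℝ 1 fun z : ℝ × ℝ => w₁ z.1 z.2)
    (h₂ : ContDiff ℝ 1 fun z : ℝ × ℝ => w₂ z.1 z.2) (x y : ℝ) :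
    dx (fun x y => w₁ x y - w₂ x y) x y = dx w₁ x y - dx w₂ x y :=
  ((hasDerivAt_dx h₁ x y).sub (hasDerivAt_dx h₂ x y)).deriv

theorem robinLeft_sub (α : ℂ) (h₁ : ContDiff ℝ 1 fun z : ℝ × ℝ => w₁ z.1 z.2)
    (h₂ : ContDiff ℝ 1 fun z : ℝ × ℝ => w₂ z.1 z.2) (x y : ℝ) :
    robinLeft α (fun x y => w₁ x y - w₂ x y) x y = robinLeft α w₁ x y - robinLeft α w₂ x y := by
  rw [robinLeft, dx_sub h₁ h₂, robinLeft, robinLeft]; ring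

theorem robinRight_sub (α : ℂ) (h₁ : ContDiff ℝ 1 fun z : ℝ × ℝ => w₁ z.1 z.2)
    (h₂ : ContDiff ℝ 1 fun z : ℝ × ℝ => w₂ z.1 z.2) (x y : ℝ) :
    robinRight α (fun x y => w₁ x y - w₂ x y) x y = robinRight α w₁ x y - robinRight α w₂ x y := by
  rw [robinRight, dx_sub h₁ h₂, robinRight, robinRight]; ring

theorem deriv_deriv_sub {f g : ℝ → ℂ} (hf : ContDiff ℝ 2 f) (hg : ContDiff ℝ 2 g) (x : ℝ) :
    deriv (deriv fun s => f s - g s) x = deriv (deriv f) x - deriv (deriv g) x := by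
  have h1 : (deriv fun s => f s - g s) = fun s => deriv f s - deriv g s := by
    ext s
    exact deriv_fun_sub (hf.differentiable two_ne_zero s) (hg.differentiable two_ne_zero s)
  rw [h1]
  exact deriv_fun_sub ((hf.differentiable_deriv_two) x) ((hg.differentiable_deriv_two) x)

theorem SolvesInStrip.sub {k σ H p q p' q' : ℝ} {f : ℝ → ℝ → ℂ}
    (h₁ : SolvesInStrip k σ H f p' q' w₁) (h₂ : SolvesInStrip k σ H f p q w₂) (hp : p' ≤ p)
    (hq : q ≤ q') : SolvesInStrip k σ H 0 p q fun x y => w₁ x y - w₂ x y := by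
  have hsub : ∀ x ∈ Set.Ioo p q, x ∈ Set.Ioo p' q' := fun x hx =>
    ⟨hp.trans_lt hx.1, hx.2.trans_le hq⟩
  refine ⟨h₁.smooth.sub h₂.smooth, fun x hx y hy => ?_, fun x hx => ?_, fun x hx => ?_⟩
  · have e₁ := h₁.equation x (hsub x hx) y hy
    have e₂ := h₂.equation x hx y hy
    have d₁ : dxx (fun x y => w₁ x y - w₂ x y) x y = dxx w₁ x y - dxx w₂ x y :=
      deriv_deriv_sub (contDiff_slice_left h₁.smooth y) (contDiff_slice_left h₂.smooth y) x
    have d₂ : dyy (fun x y => w₁ x y - w₂ x y) x y = dyy w₁ x y - dyy w₂ x y :=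
      deriv_deriv_sub (contDiff_slice_right h₁.smooth x) (contDiff_slice_right h₂.smooth x) y
    rw [d₁, d₂, Pi.zero_apply, Pi.zero_apply]
    linear_combination e₁ - e₂
  · rw [h₁.dirichlet_bottom x (hsub x hx), h₂.dirichlet_bottom x hx, sub_zero]
  · rw [h₁.dirichlet_top x (hsub x hx), h₂.dirichlet_top x hx, sub_zero]

/-! ### Fourier sine coefficients of solutions -/

theorem hasDerivAt_integral_mul (hw : ContDiff ℝ 1 fun z : ℝ × ℝ => w z.1 z.2) {φ : ℝ → ℂ}
    (hφ : Continuous φ) (a b x : ℝ) :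
    HasDerivAt (fun x => ∫ y in a..b, w x y * φ y) (∫ y in a..b, dx w x y * φ y) x := by
  have hc : Continuous fun z : ℝ × ℝ => dx w z.1 z.2 * φ z.2 :=
    ((contDiff_dx (n := 0) (by exact_mod_cast hw)).continuous).mul (hφ.comp continuous_snd)
  have hc0 : ∀ x, Continuous fun y => w x y * φ y := fun x =>
    (contDiff_slice_right hw x).continuous.mul hφ
  obtain ⟨C, hC⟩ := ((isCompact_Icc (a := x - 1) (b := x + 1)).prod
    (isCompact_uIcc (a := a) (b := b))).exists_bound_of_continuousOn hc.continuousOn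
  refine (intervalIntegral.hasDerivAt_integral_of_dominated_loc_of_deriv_le
    (F := fun x y => w x y * φ y) (F' := fun x y => dx w x y * φ y) (bound := fun _ => C)
    (Icc_mem_nhds (by linarith : x - 1 < x) (by linarith : x < x + 1))
    (Eventually.of_forall fun x => (hc0 x).aestronglyMeasurable)
    ((hc0 x).intervalIntegrable _ _) ?_ ?_ intervalIntegrable_const ?_).2
  · exact (hc.comp (continuous_const.prodMk continuous_id)).aestronglyMeasurable
  · exact Eventually.of_forall fun y hy x hx => hC (x, y) ⟨hx, Set.uIoc_subset_uIcc hy⟩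
  · exact Eventually.of_forall fun y _ x _ => (hasDerivAt_dx hw x y).mul_const (φ y)

theorem hasDerivAt_sineCoeff (hw : ContDiff ℝ 1 fun z : ℝ × ℝ => w z.1 z.2) (H : ℝ) (m : ℕ)
    (x : ℝ) : HasDerivAt (fun x => sineCoeff H m (w x)) (sineCoeff H m (dx w x)) x :=
  (hasDerivAt_integral_mul hw (by fun_prop) 0 H x).const_mul _

theorem continuous_sineCoeff (hw : Continuous fun z : ℝ × ℝ => w z.1 z.2) (H : ℝ) (m : ℕ) :
    Continuous fun x => sineCoeff H m (w x) := by
  refine continuous_const.mul ?_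
  refine intervalIntegral.continuous_parametric_intervalIntegral_of_continuous' ?_ 0 H
  exact hw.mul (by fun_prop)

theorem sineCoeff_congr {H : ℝ} (hH : 0 ≤ H) (m : ℕ) {φ ψ : ℝ → ℂ}
    (h : ∀ y ∈ Set.Ioo 0 H, φ y = ψ y) : sineCoeff H m φ = sineCoeff H m ψ := by
  unfold sineCoeff
  congr 1
  rw [intervalIntegral.integral_of_le hH, intervalIntegral.integral_of_le hH,
    integral_Ioc_eq_integral_Ioo, integral_Ioc_eq_integral_Ioo]
  exact setIntegral_congr_fun measurableSet_Ioo fun y hy => by simp only [h y hy]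

theorem sineCoeff_zero (H : ℝ) (m : ℕ) : sineCoeff H m (fun _ => 0) = 0 := by
  simp [sineCoeff]

theorem sineCoeff_add {φ ψ : ℝ → ℂ} (hφ : Continuous φ) (hψ : Continuous ψ) (H : ℝ) (m : ℕ) :
    sineCoeff H m (fun y => φ y + ψ y) = sineCoeff H m φ + sineCoeff H m ψ := by
  unfold sineCoeff
  simp only [add_mul]
  rw [intervalIntegral.integral_add, mul_add]
  · exact Continuous.intervalIntegrable (by fun_prop) _ _
  · exact Continuous.intervalIntegrable (by fun_prop) _ _

theorem sineCoeff_const_mul (c : ℂ) (φ : ℝ → ℂ) (H : ℝ) (m : ℕ) :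
    sineCoeff H m (fun y => c * φ y) = c * sineCoeff H m φ := by
  unfold sineCoeff
  simp only [mul_assoc, intervalIntegral.integral_const_mul]
  ring

theorem sineCoeff_robinRight (hw : ContDiff ℝ 1 fun z : ℝ × ℝ => w z.1 z.2) (H : ℝ) (m : ℕ) (α : ℂ)
    (x : ℝ) : sineCoeff H m (fun y => robinRight α w x y)
      = sineCoeff H m (dx w x) + α * sineCoeff H m (w x) := by
  have h1 : Continuous (dx w x) :=
    (contDiff_slice_right (contDiff_dx (n := 0) (by exact_mod_cast hw)) x).continuous
  have h2 : Continuous (w x) := (contDiff_slice_right hw x).continuous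
  rw [← sineCoeff_const_mul, ← sineCoeff_add h1 (by fun_prop)]
  rfl

theorem sineCoeff_robinLeft (hw : ContDiff ℝ 1 fun z : ℝ × ℝ => w z.1 z.2) (H : ℝ) (m : ℕ) (α : ℂ)
    (x : ℝ) : sineCoeff H m (fun y => robinLeft α w x y)
      = -sineCoeff H m (dx w x) + α * sineCoeff H m (w x) := by
  have h1 : Continuous (dx w x) :=
    (contDiff_slice_right (contDiff_dx (n := 0) (by exact_mod_cast hw)) x).continuous
  have h2 : Continuous (w x) := (contDiff_slice_right hw x).continuous
  rw [← neg_one_mul, ← sineCoeff_const_mul, ← sineCoeff_const_mul,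
    ← sineCoeff_add (by fun_prop) (by fun_prop)]
  simp only [neg_one_mul]
  rfl

theorem hasDerivAt_ofReal_sin (κ y : ℝ) :
    HasDerivAt (fun y : ℝ => (Real.sin (κ * y) : ℂ)) (κ * (Real.cos (κ * y) : ℂ)) y := by
  have : HasDerivAt (fun y : ℝ => Real.sin (κ * y)) (κ * Real.cos (κ * y)) y := by
    simpa [mul_comm] using ((hasDerivAt_id y).const_mul κ).sin
  simpa using this.ofReal_comp

theorem hasDerivAt_ofReal_cos (κ y : ℝ) :
    HasDerivAt (fun y : ℝ => (Real.cos (κ * y) : ℂ)) (-κ * (Real.sin (κ * y) : ℂ)) y := by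
  have : HasDerivAt (fun y : ℝ => Real.cos (κ * y)) (-κ * Real.sin (κ * y)) y := by
    simpa [mul_comm] using ((hasDerivAt_id y).const_mul κ).cos
  simpa using this.ofReal_comp

theorem fourierNumber_mul_self {H : ℝ} (hH : 0 < H) (m : ℕ) : fourierNumber H m * H = m * Real.pi := by
  unfold fourierNumber; field_simp

/-- Two integrations by parts: the sine kills the first boundary terms, the Dirichlet conditions the
second. -/
theorem sineCoeff_deriv_deriv {H : ℝ} (hH : 0 < H) (m : ℕ) {φ : ℝ → ℂ} (hφ : ContDiff ℝ 2 φ)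
    (h0 : φ 0 = 0) (h1 : φ H = 0) :
    sineCoeff H m (deriv (deriv φ)) = -(fourierNumber H m : ℂ) ^ 2 * sineCoeff H m φ := by
  set κ := fourierNumber H m with hκ
  have d1 : ∀ y, HasDerivAt φ (deriv φ y) y := fun y => (hφ.differentiable two_ne_zero y).hasDerivAt
  have d2 : ∀ y, HasDerivAt (deriv φ) (deriv (deriv φ) y) y := fun y =>
    (hφ.differentiable_deriv_two y).hasDerivAt
  have c2 : Continuous (deriv (deriv φ)) :=
    ((contDiff_succ_iff_deriv (n := 1)).1 hφ).2.2.continuous_deriv le_rfl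
  have c1 : Continuous (deriv φ) := continuous_iff_continuousAt.2 fun y => (d2 y).continuousAt
  have i1 := intervalIntegral.integral_mul_deriv_eq_deriv_mul (a := 0) (b := H)
    (fun y _ => hasDerivAt_ofReal_sin κ y) (fun y _ => d2 y)
    (Continuous.intervalIntegrable (by fun_prop) _ _) (c2.intervalIntegrable _ _)
  have i2 := intervalIntegral.integral_mul_deriv_eq_deriv_mul (a := 0) (b := H)
    (fun y _ => (hasDerivAt_ofReal_cos κ y).const_mul (κ : ℂ)) (fun y _ => d1 y)
    (Continuous.intervalIntegrable (by fun_prop) _ _) (c1.intervalIntegrable _ _)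
  have hs : Real.sin (κ * H) = 0 := by
    rw [hκ, fourierNumber_mul_self hH]; exact Real.sin_nat_mul_pi m
  rw [i2, h0, h1, hs] at i1
  have e3 : ∫ y in (0 : ℝ)..H, (κ : ℂ) * (-κ * (Real.sin (κ * y) : ℂ)) * φ y
      = -(κ : ℂ) ^ 2 * ∫ y in (0 : ℝ)..H, φ y * (Real.sin (κ * y) : ℂ) := by
    rw [← intervalIntegral.integral_const_mul]
    congr 1; ext y; ring
  rw [e3] at i1
  unfold sineCoeff
  rw [← hκ]
  have e4 : ∫ y in (0 : ℝ)..H, deriv (deriv φ) y * (Real.sin (κ * y) : ℂ)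
      = ∫ y in (0 : ℝ)..H, (Real.sin (κ * y) : ℂ) * deriv (deriv φ) y := by
    congr 1; ext y; ring
  rw [e4, i1]
  simp
  ring

/-- The Fourier coefficients of a homogeneous solution satisfy `v'' = ζ² v`. -/
theorem SolvesInStrip.sineCoeff_dxx {k σ H p q : ℝ} (hH : 0 < H)
    (hw : SolvesInStrip k σ H 0 p q w) (hpq : p < q) (m : ℕ) {x : ℝ} (hx : x ∈ Set.Icc p q) :
    sineCoeff H m (dxx w x) = zeta k σ (fourierNumber H m) ^ 2 * sineCoeff H m (w x) := by
  have hw2 : ContDiff ℝ 2 fun z : ℝ × ℝ => w z.1 z.2 := hw.smooth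
  have hw1 : ContDiff ℝ 1 fun z : ℝ × ℝ => w z.1 z.2 := hw2.of_le one_le_two
  have hxx : Continuous fun z : ℝ × ℝ => dxx w z.1 z.2 :=
    (contDiff_dx (n := 0) (contDiff_dx (n := 1) (by exact_mod_cast hw2))).continuous
  have hIoo : Set.EqOn (fun x => sineCoeff H m (dxx w x))
      (fun x => zeta k σ (fourierNumber H m) ^ 2 * sineCoeff H m (w x)) (Set.Ioo p q) := by
    intro x hx
    have hy2 := contDiff_slice_right hw2 x
    have hyy : Continuous (dyy w x) :=
      ((contDiff_succ_iff_deriv (n := 1)).1 hy2).2.2.continuous_deriv le_rfl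
    have e1 := sineCoeff_deriv_deriv hH m hy2 (hw.dirichlet_bottom x hx) (hw.dirichlet_top x hx)
    have e2 : sineCoeff H m (dxx w x) = sineCoeff H m
        (fun y => (Complex.I * k * σ - (k : ℂ) ^ 2) * w x y + -1 * dyy w x y) := by
      refine sineCoeff_congr hH.le m fun y hy => ?_
      have := hw.equation x hx y hy
      rw [Pi.zero_apply, Pi.zero_apply] at this
      linear_combination -this
    change sineCoeff H m (dxx w x) = _
    have hwc : Continuous (w x) := hy2.continuous
    rw [e2, sineCoeff_add (by fun_prop) (by fun_prop), sineCoeff_const_mul, sineCoeff_const_mul]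
    change _ + -1 * sineCoeff H m (deriv (deriv (w x))) = _
    rw [e1, zeta_sq]
    ring
  -- The equation holds only inside the strip; continuity carries the identity to the ends, where
  -- Robin traces are taken.
  exact hIoo.of_subset_closure (continuous_sineCoeff hxx H m).continuousOn
    (continuous_const.mul (continuous_sineCoeff hw1.continuous H m)).continuousOn
    Set.Ioo_subset_Icc_self (by rw [closure_Ioo hpq.ne]) hx

end Smooth

/-! ### The modal transmission problem -/

section Transmission

theorem hasDerivAt_exp_mul_sub (ζ : ℂ) (p x : ℝ) :
    HasDerivAt (fun x : ℝ => Complex.exp (ζ * (x - p))) (ζ * Complex.exp (ζ * (x - p))) x := by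
  have h : HasDerivAt (fun x : ℝ => ζ * ((x : ℂ) - p)) (ζ * 1) x :=
    (((hasDerivAt_id x).ofReal_comp).sub_const (p : ℂ)).const_mul ζ
  simpa [mul_comm] using h.cexp

theorem eq_exp_mul_of_hasDerivAt {ζ : ℂ} {p q : ℝ} {g g' : ℝ → ℂ}
    (hg : ∀ x, HasDerivAt g (g' x) x) (h : ∀ x ∈ Set.Icc p q, g' x = ζ * g x) {x : ℝ}
    (hx : x ∈ Set.Icc p q) : g x = g p * Complex.exp (ζ * (x - p)) := by
  have hd : ∀ x, HasDerivAt (fun x : ℝ => g x * Complex.exp (-ζ * (x - p)))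
      (g' x * Complex.exp (-ζ * (x - p)) + g x * (-ζ * Complex.exp (-ζ * (x - p)))) x := fun x =>
    (hg x).mul (hasDerivAt_exp_mul_sub (-ζ) p x)
  have := constant_of_has_deriv_right_zero
    (fun x _ => (hd x).continuousAt.continuousWithinAt) (fun x hx => by
      have h1 := (hd x).hasDerivWithinAt (s := Set.Ici x)
      rw [h x (Set.Ico_subset_Icc_self hx)] at h1
      convert h1 using 1
      ring) x hx
  simp only [sub_self, mul_zero, Complex.exp_zero, mul_one] at this
  rw [← this, mul_assoc, ← Complex.exp_add]
  simp

/-- The combinations `v' + ζ v` and `v' - ζ v` satisfy first-order equations with rates `ζ` and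
`-ζ`. -/
theorem exists_exp_of_hasDerivAt {ζ : ℂ} (hζ : ζ ≠ 0) {p q : ℝ} {v v' v'' : ℝ → ℂ}
    (h₁ : ∀ x, HasDerivAt v (v' x) x) (h₂ : ∀ x, HasDerivAt v' (v'' x) x)
    (h : ∀ x ∈ Set.Icc p q, v'' x = ζ ^ 2 * v x) :
    ∃ c d : ℂ, ∀ x ∈ Set.Icc p q,
      v x = c * Complex.exp (ζ * (x - p)) + d * Complex.exp (-ζ * (x - p)) ∧
      v' x = ζ * (c * Complex.exp (ζ * (x - p)) - d * Complex.exp (-ζ * (x - p))) := by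
  refine ⟨(v' p + ζ * v p) / (2 * ζ), -((v' p - ζ * v p) / (2 * ζ)), fun x hx => ?_⟩
  have e₁ := eq_exp_mul_of_hasDerivAt (ζ := ζ) (fun x => (h₂ x).add ((h₁ x).const_mul ζ))
    (fun x hx => by simp only [Pi.add_apply, h x hx]; ring) hx
  have e₂ := eq_exp_mul_of_hasDerivAt (ζ := -ζ) (fun x => (h₂ x).sub ((h₁ x).const_mul ζ))
    (fun x hx => by simp only [Pi.sub_apply, h x hx]; ring) hx
  simp only [Pi.add_apply, Pi.sub_apply] at e₁ e₂
  generalize Complex.exp (ζ * (x - p)) = E₁ at e₁ ⊢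
  generalize Complex.exp (-ζ * (x - p)) = E₂ at e₂ ⊢
  constructor
  · field_simp
    linear_combination e₁ - e₂
  · field_simp
    linear_combination e₁ + e₂

/-- The elimination of `c` and `d` that produces `a` and `b`, with abscissae measured from the left
end: inner traces at `2δ` and `L`, incoming data at `0` and `2δ + L`. -/
theorem transmission_of_exp {ζ α c d : ℂ} {δ L : ℝ} (hD : denomCoeff ζ α δ L ≠ 0) :
    ((ζ + α) * c * Complex.exp (ζ * (2 * δ)) - (ζ - α) * d * Complex.exp (-ζ * (2 * δ))
      = bCoeff ζ α δ L * (-(ζ - α) * c + (ζ + α) * d)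
        + aCoeff ζ α δ L * ((ζ + α) * c * Complex.exp (ζ * (2 * δ + L))
          - (ζ - α) * d * Complex.exp (-ζ * (2 * δ + L)))) ∧
    (-(ζ - α) * c * Complex.exp (ζ * L) + (ζ + α) * d * Complex.exp (-ζ * L)
      = bCoeff ζ α δ L * ((ζ + α) * c * Complex.exp (ζ * (2 * δ + L))
          - (ζ - α) * d * Complex.exp (-ζ * (2 * δ + L)))
        + aCoeff ζ α δ L * (-(ζ - α) * c + (ζ + α) * d)) := by
  have e₁ : ζ * (2 * δ + L) = ζ * (2 * δ) + ζ * L := by ring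
  have e₂ : -ζ * (2 * δ + L) = -(ζ * (2 * δ)) + -(ζ * L) := by ring
  have e₃ : 2 * ζ * δ = ζ * (2 * δ) := by ring
  have e₄ : -2 * ζ * δ = -(ζ * (2 * δ)) := by ring
  unfold aCoeff bCoeff
  simp only [div_mul_eq_mul_div, ← add_div]
  rw [eq_div_iff hD, eq_div_iff hD, denomCoeff, e₁, e₂, e₃, e₄, neg_mul ζ, neg_mul ζ]
  simp only [Complex.exp_add, Complex.exp_neg]
  have h1 := Complex.exp_ne_zero (ζ * (2 * δ))
  have h2 := Complex.exp_ne_zero (ζ * L)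
  constructor
  · field_simp
    ring
  · field_simp
    ring

theorem SolvesInStrip.transmission {k σ δ L H p : ℝ} (hk : 0 < k) (hσ : 0 < σ) (hδ : 0 < δ)
    (hL : 0 < L) (hH : 0 < H) {w : ℝ → ℝ → ℂ} (hw : SolvesInStrip k σ H 0 p (p + L + 2 * δ) w)
    (m : ℕ) :
    (sineCoeff H m (fun y => robinRight (impedance k) w (p + 2 * δ) y)
      = bCoeff (zeta k σ (fourierNumber H m)) (impedance k) δ L
          * sineCoeff H m (fun y => robinLeft (impedance k) w p y)
        + aCoeff (zeta k σ (fourierNumber H m)) (impedance k) δ L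
          * sineCoeff H m (fun y => robinRight (impedance k) w (p + L + 2 * δ) y)) ∧
    (sineCoeff H m (fun y => robinLeft (impedance k) w (p + L) y)
      = bCoeff (zeta k σ (fourierNumber H m)) (impedance k) δ L
          * sineCoeff H m (fun y => robinRight (impedance k) w (p + L + 2 * δ) y)
        + aCoeff (zeta k σ (fourierNumber H m)) (impedance k) δ L
          * sineCoeff H m (fun y => robinLeft (impedance k) w p y)) := by
  set ζ := zeta k σ (fourierNumber H m)
  have hx : 0 < ζ.re := zeta_re_pos hk hσ _
  have hD := denomCoeff_ne_zero hx (zeta_im_pos hk hσ _) hk hδ hL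
  have hζ : ζ ≠ 0 := fun h => by rw [h] at hx; exact lt_irrefl _ hx
  have hw2 : ContDiff ℝ 2 fun z : ℝ × ℝ => w z.1 z.2 := hw.smooth
  have hw1 : ContDiff ℝ 1 fun z : ℝ × ℝ => w z.1 z.2 := hw2.of_le one_le_two
  obtain ⟨c, d, hcd⟩ := exists_exp_of_hasDerivAt hζ
    (fun x => hasDerivAt_sineCoeff hw1 H m x)
    (fun x => hasDerivAt_sineCoeff (contDiff_dx (n := 1) (by exact_mod_cast hw2)) H m x)
    (fun x hx => hw.sineCoeff_dxx hH (by linarith) m hx)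
  obtain ⟨v₀, w₀⟩ := hcd p ⟨by linarith, by linarith⟩
  obtain ⟨v₁, w₁⟩ := hcd (p + 2 * δ) ⟨by linarith, by linarith⟩
  obtain ⟨v₂, w₂⟩ := hcd (p + L) ⟨by linarith, by linarith⟩
  obtain ⟨v₃, w₃⟩ := hcd (p + L + 2 * δ) ⟨by linarith, by linarith⟩
  have s₁ : ((p + 2 * δ : ℝ) : ℂ) - p = 2 * δ := by push_cast; ring
  have s₂ : ((p + L : ℝ) : ℂ) - p = L := by push_cast; ring
  have s₃ : ((p + L + 2 * δ : ℝ) : ℂ) - p = 2 * δ + L := by push_cast; ring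
  rw [sub_self, mul_zero, mul_zero, Complex.exp_zero] at v₀ w₀
  rw [s₁] at v₁ w₁
  rw [s₂] at v₂ w₂
  rw [s₃] at v₃ w₃
  obtain ⟨t₁, t₂⟩ := transmission_of_exp (c := c) (d := d) hD
  rw [sineCoeff_robinRight hw1, sineCoeff_robinRight hw1, sineCoeff_robinLeft hw1,
    sineCoeff_robinLeft hw1, v₀, w₀, v₁, w₁, v₂, w₂, v₃, w₃]
  constructor
  · linear_combination t₁
  · linear_combination t₂

end Transmission

/-! ### The iteration matrix propagates the interface data -/

section Propagation

variable {k σ δ L H a₁ : ℝ} {N : ℕ}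

theorem leftEnd_succ (a₁ L : ℝ) (j : ℕ) : leftEnd a₁ L (j + 1) = leftEnd a₁ L j + L := by
  unfold leftEnd; push_cast; ring

theorem rightEnd_eq (a₁ L δ : ℝ) (j : ℕ) : rightEnd a₁ L δ j = leftEnd a₁ L (j + 1) + 2 * δ := by
  rw [leftEnd_succ]; rfl

theorem leftEnd_mono (a₁ : ℝ) (hL : 0 ≤ L) : Monotone (leftEnd a₁ L) :=
  monotone_nat_of_le_succ fun j => by rw [leftEnd_succ]; linarith

theorem rightEnd_mono (a₁ δ : ℝ) (hL : 0 ≤ L) : Monotone (rightEnd a₁ L δ) := fun i j hij => by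
  have := leftEnd_mono a₁ hL hij
  unfold rightEnd
  linarith

/-- The zero values at `i = N - 1` and `j = 0` stand for the vanishing error data at the two outer
ends of the wave guide. -/
theorem interfaceData_eq_interleave (k δ L H : ℝ) (N : ℕ) (a₁ : ℝ) (m : ℕ) (e : ℕ → ℝ → ℝ → ℂ) :
    interfaceData k δ L H N a₁ m e = interleave (N - 1)
      (fun i => if i < N - 1 then sineCoeff H m
        (fun y => robinRight (impedance k) (e (i + 2)) (rightEnd a₁ L δ (i + 1)) y) else 0)
      (fun j => if j = 0 then 0 else sineCoeff H m
        (fun y => robinLeft (impedance k) (e j) (leftEnd a₁ L (j + 1)) y)) := by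
  ext ⟨i, p⟩
  fin_cases p <;> simp [interfaceData, interleave]

variable {f : ℝ → ℝ → ℂ} {g₁ g₂ : ℝ → ℂ} {u : ℝ → ℝ → ℂ} {U : ℕ → ℕ → ℝ → ℝ → ℂ}

theorem IsSchwarzIteration.contDiff (hU : IsSchwarzIteration k σ δ L H N a₁ f g₁ g₂ U) (n : ℕ)
    {j : ℕ} (hj : j ∈ Set.Icc 1 N) : ContDiff ℝ 2 fun z : ℝ × ℝ => U n j z.1 z.2 := by
  cases n with
  | zero => exact hU.initial_smooth j hj
  | succ n => exact (hU.interior n j hj).smooth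

theorem IsWaveguideSolution.error_solvesInStrip (hL : 0 < L)
    (hu : IsWaveguideSolution k σ δ L H N a₁ f g₁ g₂ u)
    (hU : IsSchwarzIteration k σ δ L H N a₁ f g₁ g₂ U) (n : ℕ) {j : ℕ} (hj : j ∈ Set.Icc 1 N) :
    SolvesInStrip k σ H 0 (leftEnd a₁ L j) (leftEnd a₁ L j + L + 2 * δ)
      (fun x y => u x y - U (n + 1) j x y) :=
  hu.interior.sub (hU.interior n j hj) (leftEnd_mono a₁ hL.le hj.1)
    (rightEnd_mono a₁ δ hL.le hj.2)

theorem isModeIterationMatrix_iterMatrix (hk : 0 < k) (hσ : 0 < σ) (hδ : 0 < δ) (hL : 0 < L)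
    (hH : 0 < H) (N m : ℕ) :
    IsModeIterationMatrix k σ δ L H N m (iterMatrix k σ δ L (fourierNumber H m) N) := by
  intro a₁ f g₁ g₂ u U hu hU n
  have hu1 : ContDiff ℝ 1 fun z : ℝ × ℝ => u z.1 z.2 := hu.interior.smooth.of_le one_le_two
  have hU1 : ∀ n j, j ∈ Set.Icc 1 N → ContDiff ℝ 1 fun z : ℝ × ℝ => U n j z.1 z.2 :=
    fun n j hj => (hU.contDiff n hj).of_le one_le_two
  have left_eq : ∀ j, j + 2 ≤ N →
      sineCoeff H m (fun y => robinLeft (impedance k) (fun x y => u x y - U (n + 1) (j + 2) x y)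
        (leftEnd a₁ L (j + 2)) y)
      = sineCoeff H m (fun y => robinLeft (impedance k) (fun x y => u x y - U n (j + 1) x y)
        (leftEnd a₁ L (j + 2)) y) := fun j hj => by
    refine sineCoeff_congr hH.le m fun y hy => ?_
    rw [robinLeft_sub _ hu1 (hU1 _ _ ⟨by omega, by omega⟩),
      robinLeft_sub _ hu1 (hU1 _ _ ⟨by omega, by omega⟩),
      hU.left_transmission n (j + 2) ⟨by omega, hj⟩ y hy]
    rfl
  have left_zero : 1 ≤ N →
      sineCoeff H m (fun y => robinLeft (impedance k) (fun x y => u x y - U (n + 1) 1 x y)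
        (leftEnd a₁ L 1) y) = 0 := fun hN => by
    rw [← sineCoeff_zero H m]
    refine sineCoeff_congr hH.le m fun y hy => ?_
    rw [robinLeft_sub _ hu1 (hU1 _ _ ⟨le_rfl, hN⟩), hu.left_end y hy, hU.left_end n y hy, sub_self]
  have right_eq : ∀ j, 1 ≤ j → j < N →
      sineCoeff H m (fun y => robinRight (impedance k) (fun x y => u x y - U (n + 1) j x y)
        (rightEnd a₁ L δ j) y)
      = sineCoeff H m (fun y => robinRight (impedance k) (fun x y => u x y - U n (j + 1) x y)
        (rightEnd a₁ L δ j) y) := fun j hj hjN => by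
    refine sineCoeff_congr hH.le m fun y hy => ?_
    rw [robinRight_sub _ hu1 (hU1 _ _ ⟨by omega, by omega⟩),
      robinRight_sub _ hu1 (hU1 _ _ ⟨by omega, by omega⟩),
      hU.right_transmission n j ⟨hj, hjN⟩ y hy]
  have right_zero : 1 ≤ N →
      sineCoeff H m (fun y => robinRight (impedance k) (fun x y => u x y - U (n + 1) N x y)
        (rightEnd a₁ L δ N) y) = 0 := fun hN => by
    rw [← sineCoeff_zero H m]
    refine sineCoeff_congr hH.le m fun y hy => ?_
    rw [robinRight_sub _ hu1 (hU1 _ _ ⟨hN, le_rfl⟩), hu.right_end y hy, hU.right_end n y hy,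
      sub_self]
  rw [iterMatrix, interfaceData_eq_interleave, interfaceData_eq_interleave,
    blockToeplitz_mulVec_interleave _ _ _ _ _ (by simp) (by simp)]
  ext ⟨⟨i, hi⟩, p⟩
  fin_cases p
  · obtain ⟨t, -⟩ := (hu.error_solvesInStrip hL hU n (j := i + 2)
      ⟨by omega, by omega⟩).transmission hk hσ hδ hL hH m
    rw [left_eq i (by omega)] at t
    have hr : rightEnd a₁ L δ (i + 1) = leftEnd a₁ L (i + 2) + 2 * δ := rightEnd_eq _ _ _ _
    simp only [interleave, Fin.zero_eta, if_true, hi, hr, t, Nat.succ_ne_zero, if_false]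
    congr 2
    change sineCoeff H m (fun y => robinRight (impedance k)
      (fun x y => u x y - U (n + 1) (i + 2) x y) (rightEnd a₁ L δ (i + 2)) y) = _
    split_ifs with h
    · exact right_eq (i + 2) (by omega) (by omega)
    · obtain rfl : N = i + 2 := by omega
      exact right_zero (by omega)
  · obtain ⟨-, t⟩ := (hu.error_solvesInStrip hL hU n (j := i + 1)
      ⟨by omega, by omega⟩).transmission hk hσ hδ hL hH m
    have t' := right_eq (i + 1) (by omega) (by omega)
    have hr : leftEnd a₁ L (i + 1) + L + 2 * δ = rightEnd a₁ L δ (i + 1) := rfl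
    rw [hr, t', ← leftEnd_succ] at t
    simp only [interleave, Fin.mk_one, one_ne_zero, if_false, Nat.succ_ne_zero, Nat.add_sub_cancel,
      hi, if_true]
    rw [t]
    congr 2
    split_ifs with h
    · subst h
      exact left_zero (by omega)
    · obtain ⟨j, rfl⟩ : ∃ j, i = j + 1 := ⟨i - 1, by omega⟩
      exact left_eq j (by omega)

end Propagation

/-! ### Single-mode Schwarz iterations with prescribed initial interface data -/

section Modal

variable {k σ δ L H κ : ℝ}

/-- The separated function `v(x) sin(κ y)`. -/
def modal (κ : ℝ) (v : ℝ → ℂ) (x y : ℝ) : ℂ := v x * (Real.sin (κ * y) : ℂ)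

theorem contDiff_modal {v : ℝ → ℂ} (hv : ContDiff ℝ 2 v) (κ : ℝ) :
    ContDiff ℝ 2 fun z : ℝ × ℝ => modal κ v z.1 z.2 := by
  have h1 : ContDiff ℝ 2 fun z : ℝ × ℝ => Real.sin (κ * z.2) := by fun_prop
  exact (hv.comp contDiff_fst).mul (Complex.ofRealCLM.contDiff.comp h1)

theorem dx_modal (κ : ℝ) (v : ℝ → ℂ) (x y : ℝ) :
    dx (modal κ v) x y = deriv v x * (Real.sin (κ * y) : ℂ) :=
  deriv_mul_const_field _

theorem robinLeft_modal (α : ℂ) (κ : ℝ) (v : ℝ → ℂ) (x y : ℝ) :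
    robinLeft α (modal κ v) x y = (-deriv v x + α * v x) * (Real.sin (κ * y) : ℂ) := by
  rw [robinLeft, dx_modal, modal]; ring

theorem robinRight_modal (α : ℂ) (κ : ℝ) (v : ℝ → ℂ) (x y : ℝ) :
    robinRight α (modal κ v) x y = (deriv v x + α * v x) * (Real.sin (κ * y) : ℂ) := by
  rw [robinRight, dx_modal, modal]; ring

theorem dxx_modal (κ : ℝ) (v : ℝ → ℂ) (x y : ℝ) :
    dxx (modal κ v) x y = deriv (deriv v) x * (Real.sin (κ * y) : ℂ) := by
  have : dxx (modal κ v) x y = deriv (fun s => dx (modal κ v) s y) x := rfl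
  simp only [this, dx_modal]
  exact deriv_mul_const_field _

theorem dyy_modal (κ : ℝ) (v : ℝ → ℂ) (x y : ℝ) :
    dyy (modal κ v) x y = -(κ : ℂ) ^ 2 * modal κ v x y := by
  have h1 : (deriv fun s => modal κ v x s) = fun s => v x * (κ * (Real.cos (κ * s) : ℂ)) := by
    ext s
    exact ((hasDerivAt_ofReal_sin κ s).const_mul (v x)).deriv
  rw [dyy, h1, (((hasDerivAt_ofReal_cos κ y).const_mul (κ : ℂ)).const_mul (v x)).deriv, modal]
  ring

theorem solvesInStrip_modal (hH : 0 < H) (m : ℕ) {v : ℝ → ℂ} (hv : ContDiff ℝ 2 v)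
    (h : ∀ x, deriv (deriv v) x = zeta k σ (fourierNumber H m) ^ 2 * v x) (p q : ℝ) :
    SolvesInStrip k σ H 0 p q (modal (fourierNumber H m) v) where
  smooth := contDiff_modal hv _
  equation x _ y _ := by
    rw [dxx_modal, dyy_modal, h, zeta_sq, modal]
    simp only [Pi.zero_apply]
    ring
  dirichlet_bottom x _ := by simp [modal]
  dirichlet_top x _ := by
    rw [modal, fourierNumber_mul_self hH, Real.sin_nat_mul_pi]; simp

theorem sineCoeff_const_mul_sin (hH : 0 < H) {m : ℕ} (hm : 1 ≤ m) (c : ℂ) :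
    sineCoeff H m (fun y => c * (Real.sin (fourierNumber H m * y) : ℂ)) = c := by
  rw [sineCoeff_const_mul]
  have hκ := fourierNumber_pos hH hm
  have h1 : ∫ y in (0 : ℝ)..H, Real.sin (fourierNumber H m * y) ^ 2 = H / 2 := by
    rw [intervalIntegral.integral_comp_mul_left (fun t => Real.sin t ^ 2) hκ.ne', integral_sin_sq,
      fourierNumber_mul_self hH, Real.sin_nat_mul_pi, ← fourierNumber_mul_self hH]
    simp
    field_simp
  have h2 : ∫ y in (0 : ℝ)..H, (Real.sin (fourierNumber H m * y) : ℂ)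
      * (Real.sin (fourierNumber H m * y) : ℂ) = ((H / 2 : ℝ) : ℂ) := by
    rw [← h1, ← intervalIntegral.integral_ofReal]
    congr 1; ext y; push_cast; ring
  rw [sineCoeff, h2, ← Complex.ofReal_mul]
  have : 2 / H * (H / 2) = 1 := by field_simp
  rw [this]
  simp

/-- The combination `c e^{ζ (x - p)} + d e^{-ζ (x - q)}`. -/
def expPair (ζ c d : ℂ) (p q x : ℝ) : ℂ :=
  c * Complex.exp (ζ * (x - p)) + d * Complex.exp (-ζ * (x - q))

theorem contDiff_expPair (ζ c d : ℂ) (p q : ℝ) : ContDiff ℝ 2 (expPair ζ c d p q) := by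
  have h : ∀ (ζ : ℂ) (p : ℝ), ContDiff ℝ 2 fun x : ℝ => Complex.exp (ζ * (x - p)) := fun ζ p =>
    (contDiff_const.mul (Complex.ofRealCLM.contDiff.sub contDiff_const)).cexp
  exact (contDiff_const.mul (h ζ p)).add (contDiff_const.mul (h (-ζ) q))

theorem deriv_expPair (ζ c d : ℂ) (p q : ℝ) :
    deriv (expPair ζ c d p q) = expPair ζ (ζ * c) (-ζ * d) p q := by
  ext x
  refine (((hasDerivAt_exp_mul_sub ζ p x).const_mul c).add
    ((hasDerivAt_exp_mul_sub (-ζ) q x).const_mul d)).deriv.trans ?_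
  rw [expPair]
  ring

theorem deriv_deriv_expPair (ζ c d : ℂ) (p q x : ℝ) :
    deriv (deriv (expPair ζ c d p q)) x = ζ ^ 2 * expPair ζ c d p q x := by
  rw [deriv_expPair, deriv_expPair, expPair, expPair]; ring

/-- The two boundary conditions form a 2 × 2 system for the exponential coefficients whose
determinant is `-D`; the witnesses come from Cramer's rule. -/
theorem exists_modal_solution {ζ α : ℂ} (hD : denomCoeff ζ α δ L ≠ 0) (p : ℝ) (gl gr : ℂ) :
    ∃ v : ℝ → ℂ, ContDiff ℝ 2 v ∧ (∀ x, deriv (deriv v) x = ζ ^ 2 * v x) ∧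
      -deriv v p + α * v p = gl ∧
      deriv v (p + L + 2 * δ) + α * v (p + L + 2 * δ) = gr := by
  set E := Complex.exp (ζ * (2 * δ + L)) with hE
  have hE0 : E ≠ 0 := Complex.exp_ne_zero _
  have hEn : Complex.exp (-ζ * (2 * δ + L)) = E⁻¹ := by rw [neg_mul, Complex.exp_neg]
  have hDE : denomCoeff ζ α δ L = (ζ + α) ^ 2 * E - (ζ - α) ^ 2 * E⁻¹ := by rw [denomCoeff, hEn]
  refine ⟨expPair ζ (((ζ - α) * E⁻¹ * gl + (ζ + α) * gr) / denomCoeff ζ α δ L)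
    (((ζ + α) * E * gl + (ζ - α) * gr) / denomCoeff ζ α δ L) p p, contDiff_expPair _ _ _ _ _,
    deriv_deriv_expPair _ _ _ _ _, ?_, ?_⟩
  · simp only [deriv_expPair, expPair, sub_self, mul_zero, Complex.exp_zero, mul_one]
    field_simp
    rw [hDE]
    field_simp
    ring
  · have s : ((p + L + 2 * δ : ℝ) : ℂ) - p = 2 * δ + L := by push_cast; ring
    simp only [deriv_expPair, expPair, s, hEn, ← hE]
    field_simp
    rw [hDE]
    field_simp
    ring

/-- Every vector is the initial interface data of a Schwarz iteration for the trivial solution. -/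
theorem exists_isSchwarzIteration (hk : 0 < k) (hσ : 0 < σ) (hδ : 0 < δ) (hL : 0 < L) (hH : 0 < H)
    (N : ℕ) {m : ℕ} (hm : 1 ≤ m) (z : Fin (N - 1) × Fin 2 → ℂ) :
    ∃ U : ℕ → ℕ → ℝ → ℝ → ℂ, IsSchwarzIteration k σ δ L H N 0 0 0 0 U ∧
      interfaceData k δ L H N 0 m (fun j x y => 0 - U 0 j x y) = z := by
  set κ := fourierNumber H m with hκ
  set ζ := zeta k σ κ with hζ
  set α := impedance k with hα
  have hα0 : α ≠ 0 := mul_ne_zero Complex.I_ne_zero (by exact_mod_cast hk.ne')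
  have hD : denomCoeff ζ α δ L ≠ 0 :=
    denomCoeff_ne_zero (zeta_re_pos hk hσ _) (zeta_im_pos hk hσ _) hk hδ hL
  obtain ⟨R, S, -, -, rfl⟩ := exists_interleave (N - 1) z
  choose sol sol_smooth sol_eq sol_left sol_right using exists_modal_solution hD
  -- The initial guess need not solve the equation, so the exponent `α` is allowed: the left Robin
  -- operator annihilates `e^{αx}` and the right one `e^{-αx}`. The two traces of strip `j` thus
  -- decouple, each exponential giving `2α` times its coefficient at its base point; the minus signs
  -- account for the error being `0 - U`.
  set V₀ : ℕ → ℝ → ℂ := fun j => expPair α (-(R (j - 2) / (2 * α))) (-(S j / (2 * α)))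
    (rightEnd 0 L δ (j - 1)) (leftEnd 0 L (j + 1)) with hV₀
  set V : ℕ → ℕ → ℝ → ℂ := fun n => Nat.rec V₀ (fun _ W j => sol (leftEnd 0 L j)
    (if 2 ≤ j then -deriv (W (j - 1)) (leftEnd 0 L j) + α * W (j - 1) (leftEnd 0 L j) else 0)
    (if j < N then deriv (W (j + 1)) (rightEnd 0 L δ j) + α * W (j + 1) (rightEnd 0 L δ j) else 0))
    n with hV
  have V_left : ∀ n j, -deriv (V (n + 1) j) (leftEnd 0 L j) + α * V (n + 1) j (leftEnd 0 L j)
      = if 2 ≤ j then -deriv (V n (j - 1)) (leftEnd 0 L j) + α * V n (j - 1) (leftEnd 0 L j)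
        else 0 := fun n j => sol_left _ _ _
  have V_right : ∀ n j,
      deriv (V (n + 1) j) (rightEnd 0 L δ j) + α * V (n + 1) j (rightEnd 0 L δ j)
      = if j < N then deriv (V n (j + 1)) (rightEnd 0 L δ j) + α * V n (j + 1) (rightEnd 0 L δ j)
        else 0 := fun n j => sol_right _ _ _
  refine ⟨fun n j => modal κ (V n j), ⟨fun j _ => contDiff_modal (contDiff_expPair _ _ _ _ _) _,
    fun n j _ => solvesInStrip_modal hH m (sol_smooth _ _ _) (sol_eq _ _ _) _ _, ?_, ?_, ?_, ?_⟩, ?_⟩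
  · intro n j hj y _
    rw [robinLeft_modal, robinLeft_modal, V_left, if_pos hj.1]
  · intro n j hj y _
    rw [robinRight_modal, robinRight_modal, V_right, if_pos hj.2]
  · intro n y _
    rw [robinLeft_modal, V_left, if_neg (by norm_num), zero_mul, Pi.zero_apply]
  · intro n y _
    rw [robinRight_modal, V_right, if_neg (lt_irrefl N), zero_mul, Pi.zero_apply]
  · have hneg : ∀ j, (fun x y => 0 - modal κ (V 0 j) x y)
        = modal κ (expPair α (R (j - 2) / (2 * α)) (S j / (2 * α))
            (rightEnd 0 L δ (j - 1)) (leftEnd 0 L (j + 1))) := by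
      intro j
      ext x y
      change 0 - modal κ (V₀ j) x y = _
      simp only [modal, hV₀, expPair]
      ring
    ext ⟨i, p⟩
    simp only [interfaceData, interleave, hneg]
    fin_cases p
    · simp only [Fin.zero_eta, if_true, robinRight_modal]
      rw [sineCoeff_const_mul_sin hH hm]
      simp only [deriv_expPair, expPair, Nat.add_sub_cancel, Nat.add_succ_sub_one, sub_self,
        mul_zero, Complex.exp_zero]
      field_simp
      ring
    · simp only [Fin.mk_one, one_ne_zero, if_false, robinLeft_modal]
      rw [sineCoeff_const_mul_sin hH hm]
      simp only [deriv_expPair, expPair, sub_self, mul_zero, Complex.exp_zero]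
      field_simp
      ring

theorem isModeIterationMatrix_iff (hk : 0 < k) (hσ : 0 < σ) (hδ : 0 < δ) (hL : 0 < L) (hH : 0 < H)
    (N : ℕ) {m : ℕ} (hm : 1 ≤ m) (T : Matrix (Fin (N - 1) × Fin 2) (Fin (N - 1) × Fin 2) ℂ) :
    IsModeIterationMatrix k σ δ L H N m T ↔ T = iterMatrix k σ δ L (fourierNumber H m) N := by
  constructor
  · intro hT
    -- The step from `n = 0` to `n = 1` already determines `T`, as the initial data range over all
    -- vectors.
    refine Matrix.toLin'.injective (LinearMap.ext fun z => ?_)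
    obtain ⟨U, hU, hz⟩ := exists_isSchwarzIteration hk hσ hδ hL hH N hm z
    have hu : IsWaveguideSolution k σ δ L H N 0 0 0 0 (fun _ _ => 0) := by
      refine ⟨⟨contDiff_const, ?_, ?_, ?_⟩, ?_, ?_⟩ <;>
        simp [dxx, dyy, robinLeft, robinRight, dx]
    have h1 := hT 0 0 0 0 _ U hu hU 0
    have h2 := isModeIterationMatrix_iterMatrix hk hσ hδ hL hH N m 0 0 0 0 _ U hu hU 0
    rw [hz] at h1 h2
    rw [Matrix.toLin'_apply, Matrix.toLin'_apply, ← h1, ← h2]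
  · rintro rfl
    exact isModeIterationMatrix_iterMatrix hk hσ hδ hL hH N m

end Modal

end Waveguide

end

theorem theorem4p1 :
    -- `iterMatrix` is exactly the matrix by which the parallel Schwarz method propagates the
    -- interface data of a Fourier mode
    (∀ k σ δ L H : ℝ, 0 < k → 0 < σ → 0 < δ → 0 < L → 0 < H →
      ∀ N m : ℕ, 2 ≤ N → 1 ≤ m →
      ∀ T : Matrix (Fin (N - 1) × Fin 2) (Fin (N - 1) × Fin 2) ℂ,
        Waveguide.IsModeIterationMatrix k σ δ L H N m T ↔
          T = Waveguide.iterMatrix k σ δ L (Waveguide.fourierNumber H m) N) ∧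
    -- the limiting convergence factor of every Fourier number exists
    (∀ k σ δ L κ : ℝ, 0 < k → 0 < σ → 0 < δ → 0 < L → 0 < κ →
      Tendsto (fun N : ℕ => spectralRadius ℂ (Waveguide.iterMatrix k σ δ L κ N)) atTop
        (𝓝 (Waveguide.factor1d k σ δ L κ))) ∧
    -- evanescent modes
    (∀ k σ δ L κ : ℝ, 0 < k → 0 < σ → 0 < δ → 0 < L → k < κ →
      Waveguide.factor1d k σ δ L κ < 1) ∧
    -- `σ`, `δ`, `L` between them sufficiently large
    (∀ k ε : ℝ, 0 < k → 0 < ε → ∃ C : ℝ, 0 < C ∧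
      ∀ σ δ L H : ℝ, ε ≤ σ → 0 < δ → 0 < L → 0 < H → (C ≤ σ ∨ C ≤ δ ∨ C ≤ L) →
        Waveguide.factor2d k σ δ L H < 1) ∧
    -- the case `σ ≥ k`
    (∀ k σ δ L H : ℝ, 0 < k → 0 < δ → 0 < L → 0 < H → k ≤ σ →
      Waveguide.factor2d k σ δ L H < 1) ∧
    -- scaling: the convergence is ultimately independent of the number of subdomains
    (∀ k σ δ L H : ℝ, 0 < k → 0 < σ → 0 < δ → 0 < L → 0 < H →
      Waveguide.factor2d k σ δ L H < 1 →
      ∃ q : ENNReal, q < 1 ∧ ∃ N₀ : ℕ, ∀ N ≥ N₀, ∀ m : ℕ, 1 ≤ m →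
        spectralRadius ℂ
          (Waveguide.iterMatrix k σ δ L (Waveguide.fourierNumber H m) N) ≤ q) := by
  refine ⟨?_, ?_, ?_, ?_, ?_, ?_⟩
  · intro k σ δ L H hk hσ hδ hL hH N m _ hm T
    exact Waveguide.isModeIterationMatrix_iff hk hσ hδ hL hH N hm T
  · intro k σ δ L κ hk hσ hδ hL _
    rw [Waveguide.factor1d_eq hk hσ hδ hL]
    exact Waveguide.tendsto_spectralRadius_iterMatrix hk hσ hδ hL
  · intro k σ δ L κ hk hσ hδ hL hκ
    exact Waveguide.factor1d_lt_one_of_le hk hσ hδ hL hκ.le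
  · intro k ε hk hε
    have h1 : 0 < 32 * k / ε ^ 2 := by positivity
    have h2 : 0 < 6 / ε := by positivity
    -- The sum of the three separate thresholds for `σ`, `δ` and `L` dominates each of them.
    refine ⟨k + 32 * k / ε ^ 2 + 6 / ε, by positivity, fun σ δ L H hσ hδ hL hH h => ?_⟩
    refine Waveguide.factor2d_lt_one hk (hε.trans_le hσ) hδ hL hH fun κ hκ =>
      Waveguide.factor1d_lt_one_of_large hk hε hσ hδ hL hκ ?_
    rcases h with h | h | h
    · exact Or.inl (by linarith)
    · exact Or.inr (Or.inl (by linarith))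
    · exact Or.inr (Or.inr (by linarith))
  · intro k σ δ L H hk hδ hL hH hσ
    exact Waveguide.factor2d_lt_one hk (hk.trans_le hσ) hδ hL hH fun κ _ =>
      Waveguide.factor1d_lt_one_of_absorption hk hδ hL hσ
  · intro k σ δ L H hk hσ hδ hL hH h
    -- Every finite spectral radius is below its limit, so no initial range of `N` has to be
    -- excluded.
    refine ⟨Waveguide.factor2d k σ δ L H, h, 0, fun N _ m hm => ?_⟩
    exact (Waveguide.spectralRadius_iterMatrix_le_factor1d hk hσ hδ hL N).trans
      (le_iSup₂ (f := fun (m : ℕ) (_ : 1 ≤ m) =>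
        Waveguide.factor1d k σ δ L (Waveguide.fourierNumber H m)) m hm)
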